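/- Let $F$ denote a real quadratic field with ring of integers $\mathcal O_F$, discriminant $d(F)$ and norm $\mathrm{Nm}$. Write $F=\mathbb Q(\sqrt m)$ with $m>1$ squarefree, and let $\omega=(1+\sqrt m)/2$ if $m\equiv 1 \bmod 4$ and $\omega=\sqrt m$ otherwise. Let $v=(v_1,v_2)\colon F\to\mathbb R^2$ be given by the two embeddings of $F$ into $\mathbb R$, extend the norm to $\mathbb R^2$ by $\mathrm{Nm}(x,y)=xy$, and let $D=\{a\,v(1)+b\,v(\omega): a,b\in[0,1)\}$. For $q_1,q_2\in\mathcal O_F$ with $q_2\ne 0$ put $[q_1,q_2]=q_1+1/q_2$ and $$V([q_1,q_2])=\{x\in\mathbb R^2: |\mathrm{Nm}(x-v([q_1,q_2]))|<1/|\mathrm{Nm}(q_2)|\}.$$ For a positive integer $n$ let $CF_2(n)=\{[q_1,q_2] : q_1,q_2\in\mathcal O_F,\ q_2\neq 0,\ |\mathrm{Nm}(q_2)|\le n\}$. Call $F$ *$n$-smooth euclidean* if $D\subseteq\bigcup_{q\in CF_2(n)}V(q)$. Say that $F$ *admits division in $\frac1n\mathcal O_F$* if for all $\alpha,\beta\in\mathcal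 O_F$ with $\beta\neq0$ there are $q,r\in\frac1n\mathcal O_F$ with $\alpha=q\beta+r$ and $|\mathrm{Nm}(r)|<|\mathrm{Nm}(\beta)|$. Let $n$ be a positive integer and $t=\operatorname{lcm}(1,2,\dots,n)$. Then: 1. Up to isomorphism, only finitely many real quadratic fields are $n$-smooth euclidean. 2. Up to isomorphism, only finitely many real quadratic fields admit division in $\frac1n\mathcal O_F$. 3. Every $n$-smooth euclidean real quadratic field $F$ admits division in $\frac1t\mathcal O_F$. 4. If $F$ is a real quadratic field with $d(F)>(16+6\sqrt6)^2\,t^4$, then there exists $z\in F$ such that $|\mathrm{Nm}(z-q)|>1$ for all $q\in CF_2(n)$. -/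

import Mathlib

open scoped NumberField

universe u

namespace RealQuadratic

noncomputable section

variable (F : Type u) [Field F] [NumberField F]

/-- The real plane, with one coordinate for each of the two embeddings of a real quadratic
field `F` into `ℝ`. -/
abbrev Plane : Type u := (F →+* ℝ) → ℝ

variable {F}

/-- The embedding `v = (v₁, v₂)` of `F` in the plane. -/
def toPlane (x : F) : Plane F := fun σ => σ x

/-- The extension `(x, y) ↦ x y` of the norm of `F` to the plane. -/
def planeNorm (x : Plane F) : ℝ := ∏ σ, x σ

/-- `ω` is the standard generator of the ring of integers: for the squarefree integer `m > 1` with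
`F = ℚ(√m)`, it is `(1 + √m) / 2` if `m ≡ 1 mod 4` and `√m` otherwise. -/
def IsStandardGenerator (ω : F) : Prop :=
  ∃ (m : ℕ) (s : F), 1 < m ∧ Squarefree m ∧ s ^ 2 = (m : F) ∧
    ω = if m % 4 = 1 then (1 + s) / 2 else s

/-- The half-open fundamental parallelogram `{a v(1) + b v(ω) : a, b ∈ [0, 1)}`. -/
def fundDomain (ω : F) : Set (Plane F) :=
  {x | ∃ a ∈ Set.Ico (0 : ℝ) 1, ∃ b ∈ Set.Ico (0 : ℝ) 1,
    x = a • toPlane (1 : F) + b • toPlane ω}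

/-- The continued fraction `[q₁, q₂] = q₁ + 1 / q₂` (used for `q₂ ≠ 0` only). -/
def contFrac (q₁ q₂ : 𝓞 F) : F := (q₁ : F) + 1 / (q₂ : F)

variable (F) in
/-- The pairs `(q₁, q₂)` that give continued fractions `[q₁, q₂]` with `|Nm q₂| ≤ n`. -/
def denomLE (n : ℕ) : Set (𝓞 F × 𝓞 F) :=
  {p | p.2 ≠ 0 ∧ |Algebra.norm ℚ (p.2 : F)| ≤ (n : ℚ)}

variable (F) in
/-- The set `CF₂(n)` of continued fractions `[q₁, q₂]` with `|Nm q₂| ≤ n`. -/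
def CF₂ (n : ℕ) : Set F := {q | ∃ p ∈ denomLE F n, q = contFrac p.1 p.2}

/-- The region `V([q₁, q₂])`, that is, all `x` in the plane with
`|Nm (x - [q₁, q₂])| < 1 / |Nm q₂|`. -/
def V (q₁ q₂ : 𝓞 F) : Set (Plane F) :=
  {x | |planeNorm (x - toPlane (contFrac q₁ q₂))| < 1 / |((Algebra.norm ℚ (q₂ : F) : ℚ) : ℝ)|}

variable (F) in
/-- `F` is `n`-smooth euclidean: the fundamental parallelogram is covered by the regions
`V([q₁, q₂])` with `|Nm q₂| ≤ n`. -/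
def IsSmoothEuclidean (n : ℕ) : Prop :=
  ∃ ω : F, IsStandardGenerator ω ∧ fundDomain ω ⊆ ⋃ p ∈ denomLE F n, V p.1 p.2

variable (F) in
/-- The set `(1 / n) 𝓞 F`. -/
def fracIntegers (n : ℕ) : Set F := {x | ∃ γ : 𝓞 F, x = (γ : F) / (n : F)}

variable (F) in
/-- Division of integers of `F` with quotient and remainder in `(1 / n) 𝓞 F` and a remainder of
smaller norm than the divisor. -/
def HasFracDivision (n : ℕ) : Prop :=
  ∀ α β : 𝓞 F, β ≠ 0 → ∃ q ∈ fracIntegers F n, ∃ r ∈ fracIntegers F n,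
    (α : F) = q * (β : F) + r ∧ |Algebra.norm ℚ r| < |Algebra.norm ℚ (β : F)|

/-- Up to isomorphism, only finitely many real quadratic fields have the property `P`. The finitely
many fields are represented by subfields of `ℝ`. -/
def FinitelyManySatisfy
    (P : ∀ (F : Type u) [Field F] [NumberField F], Prop) : Prop :=
  ∃ S : Finset (IntermediateField ℚ ℝ), ∀ (F : Type u) [Field F] [NumberField F]
    [Algebra.IsQuadraticExtension ℚ F] [NumberField.IsTotallyReal F],
    P F → ∃ K ∈ S, Nonempty (F ≃+* K)

end

end RealQuadratic

/-! Everything reduces to a lower bound for the euclidean minimum: if `d(F)` exceeds `(16 + 6√6)²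
T²`, some `z` in `F` satisfies `|Nm(z - q)| > T` for all integers `q` (`exists_forall_lt_norm`).
Taking `T = n²` and dividing `z` by `n` gives a point at norm distance above 1 from all of `(1/n)𝓞
F`. This rules out division in `(1/n)𝓞 F` for large discriminant, and only finitely many fields have
bounded discriminant. Since `1/q₂` is the conjugate of `q₂` divided by its norm, `CF₂(n)` lies in
`(1/t)𝓞 F`. Hence an `n`-smooth euclidean field admits division in `(1/t)𝓞 F`, and the claims on
smooth euclidean fields and on `z` follow from the bound for `(1/t)𝓞 F`.

The bound itself comes from the divided cell method. Write `𝓞 F = ℤ + ℤw`, and let `r n` be the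
complete quotients of the nearest integer expansion of `w` minus its nearest integer, which is small
under `X` and large under `Y`. Dividing by `r n` carries the grid of points `δ n + S - T * r n` with
`S`, `T` odd onto the grid of index `n + 1`, provided the digits `η n` in the recursion for `δ` have
the parity of the partial quotients. The signs of the digits are chosen so that the normalised `X`-
and `Y`-coordinates of `δ n` stay in the polygons `RegX` and `RegY` (invariance backwards and
forwards, respectively). On these polygons the four points `S, T = ±1` have large norm
(`RegX.vertex_le`). Any other point is moved through the cells until it is a vertex, or until its
coordinate is a local minimum with both neighbours at least 3 in absolute value, where a crude
estimate suffices (`abs_mul_abs_ge_of_three_le`). The expansion is eventually periodic, so `δ` can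
be chosen periodic too; this removes the error terms in the regions and places `z` in `F` rather
than merely in the plane. -/

namespace RealQuadratic

/-! ### Invariant polygons and the vertex estimate -/

/-- Region of the normalised pairs attached to the contracting direction of an expansion. -/
def RegX (ρ x : ℝ) : Prop :=
  0 ≤ x ∧ x ≤ ρ ∧ ρ ≤ 1 / 2 ∧ 2 * ρ + x ≤ 1.2

/-- Region of the normalised pairs in the expanding direction, after a partial quotient of absolute
value at least `3`. -/
def RegA (s y : ℝ) : Prop :=
  0 ≤ s ∧ s ≤ 0.382 ∧ s + y ≤ 0.765 ∧ 0.765 * s - y ≤ 0.295 ∧ y ≤ 1.46 * s ∧ -(0.46 * s) ≤ y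

/-- Region of the normalised pairs in the expanding direction, after a partial quotient `± 2`. -/
def RegB (s y : ℝ) : Prop :=
  0 ≤ s ∧ s ≤ 0.6181 ∧ s + y ≤ 0.865 ∧ s - y ≤ 0.8 ∧ y ≤ 0.46 * s ∧ -(0.46 * s) ≤ y

/-- The region in the expanding direction; a partial quotient `± 2` is followed by a change of
sign. -/
def RegY (c s y : ℝ) : Prop :=
  RegA s y ∨ (RegB s y ∧ c = -1)

lemma isClosed_regX (ρ : ℝ) : IsClosed {x | RegX ρ x} := by
  simp only [RegX, Set.ofPred_and]
  repeat' apply IsClosed.inter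
  all_goals exact isClosed_le (by fun_prop) (by fun_prop)

lemma isClosed_regY (c s : ℝ) : IsClosed {y | RegY c s y} := by
  simp only [RegY, RegA, RegB, Set.ofPred_and, Set.ofPred_or]
  apply IsClosed.union
  · repeat' apply IsClosed.inter
    all_goals exact isClosed_le (by fun_prop) (by fun_prop)
  · apply IsClosed.inter _ isClosed_const
    repeat' apply IsClosed.inter
    all_goals exact isClosed_le (by fun_prop) (by fun_prop)

lemma RegX.le {ρ x : ℝ} (h : RegX ρ x) : 0 ≤ ρ ∧ x ≤ 0.4 ∧ ρ + x ≤ 0.8 := by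
  obtain ⟨h1, h2, h3, h4⟩ := h
  refine ⟨by linarith, by linarith, by linarith⟩

lemma RegY.le {c s y : ℝ} (h : RegY c s y) : 0 ≤ s ∧ s ≤ 0.6181 ∧ |y| ≤ 0.46 := by
  rcases h with ⟨h1, h2, h3, h4, h5, h6⟩ | ⟨⟨h1, h2, h3, h4, h5, h6⟩, -⟩
  all_goals refine ⟨by linarith, by linarith, abs_le.2 ⟨by linarith, by linarith⟩⟩

/-- Backward invariance of `RegX`. -/
lemma RegX.step {ρ x c : ℝ} {k : ℤ} (h : RegX ρ x) (hc : c = 1 ∨ c = -1) (hk : 2 ≤ k)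
    (hk2 : k = 2 → c = -1) :
    0 < k - c * ρ ∧
      RegX (k - c * ρ)⁻¹ ((k - c * ρ)⁻¹ * if Odd k then 1 - x else x) := by
  have h0 := h.le
  obtain ⟨h1, h2, h3, h4⟩ := h
  have hcρ : -ρ ≤ c * ρ ∧ c * ρ ≤ ρ := by rcases hc with rfl | rfl <;> constructor <;> linarith
  have hkR : (2 : ℝ) ≤ k := by exact_mod_cast hk
  have hpos : 0 < k - c * ρ := by linarith
  refine ⟨hpos, ?_⟩
  have hcases : k = 2 ∨ k = 3 ∨ (4 : ℝ) ≤ k := by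
    rcases (by omega : k = 2 ∨ k = 3 ∨ 4 ≤ k) with h | h | h
    · exact .inl h
    · exact .inr (.inl h)
    · exact .inr (.inr (by exact_mod_cast h))
  set D := k - c * ρ with hD
  set w := if Odd k then 1 - x else x with hw
  have hw0 : 0 ≤ w ∧ w ≤ 1 := by rw [hw]; split_ifs <;> constructor <;> linarith
  -- The constant 1.2 is sharp here: equality holds for `k = 3`, `c = 1`, `ρ = 1/2`, `x = 0`.
  have key : 2 ≤ D ∧ 2 + w ≤ 1.2 * D := by
    rcases hcases with rfl | rfl | h4'
    · have := hk2 rfl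
      rw [if_neg (by decide)] at hw
      subst this
      push_cast at hD
      constructor <;> linarith
    · rw [if_pos (by decide)] at hw
      push_cast at hD
      constructor <;> linarith
    · constructor <;> linarith
  have hi : D⁻¹ * D = 1 := inv_mul_cancel₀ hpos.ne'
  have hi0 : 0 ≤ D⁻¹ := (inv_pos.2 hpos).le
  exact ⟨mul_nonneg hi0 hw0.1, by nlinarith, by nlinarith, by nlinarith⟩

/-- Forward invariance of `RegY`. -/
lemma RegY.step {s y c c' : ℝ} {k : ℤ} (h : RegY c s y) (hc : c = 1 ∨ c = -1) (hk : 2 ≤ k)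
    (hk2 : k = 2 → c' = -1) :
    0 < k - c * s ∧
      RegY c' (k - c * s)⁻¹ ((k - c * s)⁻¹ * if Odd k then 1 - c * y else c * y) := by
  have h0 := h.le
  have hy := abs_le.1 h0.2.2
  have hcs : -s ≤ c * s ∧ c * s ≤ s := by rcases hc with rfl | rfl <;> constructor <;> linarith
  have hcy : -0.46 ≤ c * y ∧ c * y ≤ 0.46 := by
    rcases hc with rfl | rfl <;> constructor <;> linarith
  have hkR : (2 : ℝ) ≤ k := by exact_mod_cast hk
  have hpos : 0 < k - c * s := by linarith
  refine ⟨hpos, ?_⟩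
  have hi : (k - c * s)⁻¹ * (k - c * s) = 1 := inv_mul_cancel₀ hpos.ne'
  have hi0 : 0 ≤ (k - c * s)⁻¹ := (inv_pos.2 hpos).le
  rcases (by omega : k = 2 ∨ 3 ≤ k) with rfl | h3
  · right
    refine ⟨?_, hk2 rfl⟩
    rw [if_neg (by decide)]
    push_cast at hi hi0 hpos ⊢
    set D := 2 - c * s with hD
    -- If `c = 1` then `s ≤ 0.382`, so `D ≥ 1.618`; 0.6181 is just above the reciprocal of this.
    have key : 1 ≤ 0.6181 * D ∧ 1 + c * y ≤ 0.865 * D ∧ 1 - c * y ≤ 0.8 * D := by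
      rcases h with ⟨h1, h2, h3, h4, h5, h6⟩ | ⟨⟨h1, h2, h3, h4, h5, h6⟩, rfl⟩
      · rcases hc with rfl | rfl <;> refine ⟨?_, ?_, ?_⟩ <;> linarith
      · refine ⟨?_, ?_, ?_⟩ <;> linarith
    exact ⟨hi0, by nlinarith, by nlinarith, by nlinarith, by nlinarith, by nlinarith⟩
  · left
    have hcases : k = 3 ∨ (4 : ℝ) ≤ k := by
      rcases (by omega : k = 3 ∨ 4 ≤ k) with h | h
      · exact .inl h
      · exact .inr (by exact_mod_cast h)
    set D := k - c * s with hD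
    set w := if Odd k then 1 - c * y else c * y with hw
    have hw0 : w ≤ 1.46 ∧ -0.46 ≤ w := by rw [hw]; split_ifs <;> constructor <;> linarith
    -- 0.382 is just above `(3 - √5)/2`, the fixed point of `s = 1/(3 - s)`, which is the extreme
    -- case `k = 3`, `c = 1`.
    have key : 1 ≤ 0.382 * D ∧ 1 + w ≤ 0.765 * D ∧ 0.765 - w ≤ 0.295 * D := by
      rcases hcases with rfl | h4
      · rw [if_pos (by decide)] at hw
        push_cast at hD
        rcases h with ⟨h1, h2, h3, h4, h5, h6⟩ | ⟨⟨h1, h2, h3, h4, h5, h6⟩, rfl⟩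
        · rcases hc with rfl | rfl <;> refine ⟨?_, ?_, ?_⟩ <;> linarith
        · refine ⟨?_, ?_, ?_⟩ <;> linarith
      · have hw1 : 0.765 - w ≤ 0.295 * D := by
          rw [hw]
          rcases h with ⟨h1, h2, h3, h4, h5, h6⟩ | ⟨⟨h1, h2, h3, h4, h5, h6⟩, rfl⟩
          · rcases hc with rfl | rfl <;> split_ifs <;> linarith
          · split_ifs <;> linarith
        have hw2 : 1 + w ≤ 0.765 * D := by
          rw [hw]
          rcases h with ⟨h1, h2, h3, h4, h5, h6⟩ | ⟨⟨h1, h2, h3, h4, h5, h6⟩, rfl⟩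
          · rcases hc with rfl | rfl <;> split_ifs <;> linarith
          · split_ifs <;> linarith
        refine ⟨?_, hw2, hw1⟩
        rcases h with ⟨h1, h2, h3, h4, h5, h6⟩ | ⟨⟨h1, h2, h3, h4, h5, h6⟩, rfl⟩ <;> linarith
    exact ⟨hi0, by nlinarith, by nlinarith, by nlinarith, by nlinarith, by nlinarith⟩

/-- A lower bound for the four vertices of a divided cell. -/
lemma RegX.vertex_le {ρ x s y c m k : ℝ} (hX : RegX ρ x) (hY : RegY c s y)
    (hc : c = 1 ∨ c = -1) (hm : m = 1 ∨ m = -1) (hk : k = 1 ∨ k = -1) :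
    0.1304 * |1 - c * ρ * s| ≤
      |1 - m * ρ + k * x| * |1 - c * m * s - k * m * c * y| := by
  have hX' := hX.le
  have hY' := hY.le
  have hy := abs_le.1 hY'.2.2
  obtain ⟨x1, x2, x3, x4⟩ := hX
  obtain ⟨ρ0, xle, ρx⟩ := hX'
  obtain ⟨s0, s1, -⟩ := hY'
  have hρs : 0 ≤ ρ * s := mul_nonneg ρ0 s0
  have hρs1 : ρ * s ≤ 1 / 2 * s := mul_le_mul_of_nonneg_right x3 s0
  have hsρ : ρ * s ≤ ρ * 0.6181 := mul_le_mul_of_nonneg_left s1 ρ0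
  rw [← abs_mul]
  refine le_trans ?_ (le_abs_self _)
  rcases hc with rfl | rfl
  · obtain ⟨h1, h2, h3, h4, h5, h6⟩ : RegA s y := by
      rcases hY with h | ⟨-, h⟩
      · exact h
      · norm_num at h
    rw [abs_of_nonneg (by linarith)]
    rcases hm with rfl | rfl <;> rcases hk with rfl | rfl
    · have e : 0 ≤ x * (1 - s - y) := mul_nonneg x1 (by linarith)
      have e1 : 0 ≤ (1 - 2 * ρ) * (1 - s - y - 0.1304) := mul_nonneg (by linarith) (by linarith)
      have e2 : 0 ≤ 2 * ρ * (0.5 * (1 - s - y) - 0.1304 * (1 - 0.5 * s)) :=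
        mul_nonneg (by linarith) (by linarith)
      linarith
    · have z0 : 0 ≤ 1 - s + y := by linarith
      have z1 : 0 ≤ 0.2 * (1 - s + y) - 0.1304 * (1 - 0.4 * s) := by linarith
      -- At `ρ = 0.4` the binding upper bound on `x` changes from `x ≤ ρ` to `2ρ + x ≤ 1.2`.
      rcases le_total ρ 0.4 with h | h
      · have e : 0 ≤ (ρ - x) * (1 - s + y) := mul_nonneg (by linarith) z0
        have e1 : 0 ≤ (1 - 2.5 * ρ) * (1 - s + y - 0.1304) :=
          mul_nonneg (by linarith) (by linarith)
        have e2 := mul_nonneg ρ0 z1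
        linarith
      · have e : 0 ≤ (1.2 - 2 * ρ - x) * (1 - s + y) := mul_nonneg (by linarith) z0
        have e1 : 0 ≤ (ρ - 0.4) * (1 - s + y + 0.1304 * s) :=
          mul_nonneg (by linarith) (by linarith)
        linarith
    · have e : 0 ≤ (ρ + x) * (1 + s + y) := mul_nonneg (by linarith) (by linarith)
      linarith
    · have e : 0 ≤ (ρ - x) * (1 + s - y) := mul_nonneg (by linarith) (by linarith)
      linarith
  · have hz : 0.135 ≤ 1 - s - y := by
      rcases hY with ⟨h1, h2, h3, h4, h5, h6⟩ | ⟨⟨h1, h2, h3, h4, h5, h6⟩, -⟩ <;> linarith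
    have hz2 : 0.2 ≤ 1 - s + y := by
      rcases hY with ⟨h1, h2, h3, h4, h5, h6⟩ | ⟨⟨h1, h2, h3, h4, h5, h6⟩, -⟩ <;> linarith
    have hz3 : 0 ≤ 0.2 * (1 + s - y) - 0.1304 * (1 + 0.4 * s) := by
      rcases hY with ⟨h1, h2, h3, h4, h5, h6⟩ | ⟨⟨h1, h2, h3, h4, h5, h6⟩, -⟩ <;> linarith
    rw [abs_of_nonneg (by linarith)]
    rcases hm with rfl | rfl <;> rcases hk with rfl | rfl
    · have e : 0 ≤ (1 - ρ + x - 0.5) * (1 + s + y) := mul_nonneg (by linarith) (by linarith)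
      linarith
    · have z0 : 0 ≤ 1 + s - y := by linarith
      rcases le_total ρ 0.4 with h | h
      · have e : 0 ≤ (ρ - x) * (1 + s - y) := mul_nonneg (by linarith) z0
        have e1 : 0 ≤ (1 - 2.5 * ρ) * (1 + s - y - 0.1304) :=
          mul_nonneg (by linarith) (by linarith)
        have e2 := mul_nonneg ρ0 hz3
        linarith
      · have e : 0 ≤ (1.2 - 2 * ρ - x) * (1 + s - y) := mul_nonneg (by linarith) z0
        have e1 : 0 ≤ (ρ - 0.4) * (1 + s - y - 0.1304 * s) :=
          mul_nonneg (by linarith) (by linarith)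
        linarith
    · have e : 0 ≤ (ρ + x) * (1 - s - y - 0.135) := mul_nonneg (by linarith) (by linarith)
      linarith
    · have e : 0 ≤ (ρ - x) * (1 - s + y) := mul_nonneg (by linarith) (by linarith)
      linarith

/-! ### Signed nearest integer expansions -/

/-- A nearest integer expansion `r (n + 1) = b n - 1 / r n` in a field with two real embeddings,
with signs `θ n`. -/
structure SignedExpansion {F : Type*} [Field F] (X Y : F →+* ℝ) where
  /-- the complete quotients -/
  r : ℕ → F
  /-- the partial quotients -/
  b : ℕ → ℤ
  /-- the signs -/
  θ : ℕ → ℤ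
  r_succ : ∀ n, r (n + 1) = b n - (r n)⁻¹
  abs_X_le : ∀ n, |X (r n)| ≤ 1 / 2
  b_mul_X_pos : ∀ n, 0 < b n * X (r n)
  two_le : ∀ n, 2 ≤ |b n|
  X_mul_X_neg : ∀ n, |b n| = 2 → X (r n) * X (r (n + 1)) < 0
  θ_zero : θ 0 = 1
  θ_succ : ∀ n, θ (n + 1) = if Odd (b n) then -(θ n * (b n).sign) else θ n * (b n).sign
  three_le : 3 ≤ |Y (r 0)|

namespace SignedExpansion

variable {F : Type*} [Field F] {X Y : F →+* ℝ} (E : SignedExpansion X Y)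

/-- The sign of the partial quotient `b n`. -/
def g (n : ℕ) : ℤ := (E.b n).sign

/-- The digit attached to the partial quotient `b n`; it has the same parity as `b n`. -/
def η (n : ℕ) : ℤ := if Odd (E.b n) then -(E.θ n * (E.b n).sign) else 0

open Classical in
/-- The sign of `Y (r n)`. -/
noncomputable def h (n : ℕ) : ℤ := if 0 < Y (E.r n) then 1 else -1

lemma b_ne_zero (n : ℕ) : E.b n ≠ 0 := by
  intro h
  have := E.two_le n
  simp [h] at this

lemma g_eq (n : ℕ) : E.g n = 1 ∨ E.g n = -1 := by
  rcases lt_or_gt_of_ne (E.b_ne_zero n) with h | h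
  · exact .inr (Int.sign_eq_neg_one_of_neg h)
  · exact .inl (Int.sign_eq_one_of_pos h)

lemma h_eq (n : ℕ) : E.h n = 1 ∨ E.h n = -1 := by
  unfold h; split_ifs <;> simp

lemma b_eq (n : ℕ) : E.b n = E.g n * |E.b n| := (Int.sign_mul_abs _).symm

lemma X_eq (n : ℕ) : X (E.r n) = E.g n * |X (E.r n)| := by
  have h1 := E.b_mul_X_pos n
  rcases lt_or_gt_of_ne (E.b_ne_zero n) with h | h
  · have hb : (E.b n : ℝ) < 0 := by exact_mod_cast h
    have hx : X (E.r n) < 0 := by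
      by_contra! hx
      nlinarith
    simp [g, Int.sign_eq_neg_one_of_neg h, abs_of_neg hx]
  · have hb : (0 : ℝ) < E.b n := by exact_mod_cast h
    have hx : 0 < X (E.r n) := (mul_pos_iff_of_pos_left hb).1 h1
    simp [g, Int.sign_eq_one_of_pos h, abs_of_pos hx]

lemma Y_eq (n : ℕ) : Y (E.r n) = E.h n * |Y (E.r n)| := by
  unfold h
  split_ifs with h
  · simp [abs_of_pos h]
  · simp [abs_of_nonpos (not_lt.1 h)]

lemma X_ne_zero (n : ℕ) : X (E.r n) ≠ 0 := fun h => by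
  simpa [h] using E.b_mul_X_pos n

lemma r_ne_zero (n : ℕ) : E.r n ≠ 0 := fun h => E.X_ne_zero n (by simp [h])

lemma Y_ne_zero (n : ℕ) : Y (E.r n) ≠ 0 := by
  simpa using E.r_ne_zero n

lemma θ_eq (n : ℕ) : E.θ n = 1 ∨ E.θ n = -1 := by
  induction n with
  | zero => exact .inl E.θ_zero
  | succ n ih =>
    rw [E.θ_succ]
    have := E.g_eq n
    unfold g at this
    split_ifs <;> rcases ih with h | h <;> rcases this with h' | h' <;> simp [h, h']

lemma η_eq (n : ℕ) : E.η n = if Odd (E.b n) then E.θ (n + 1) else 0 := by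
  rw [E.θ_succ]; unfold η; split_ifs <;> rfl

lemma abs_η_le (n : ℕ) : |E.η n| ≤ 1 := by
  rw [E.η_eq]
  rcases E.θ_eq (n + 1) with h | h <;> split_ifs <;> simp [h]

/-- This parity keeps the coordinates `S`, `T` odd when passing from one cell to the next. -/
lemma even_b_sub_η (n : ℕ) : Even (E.b n - E.η n) := by
  rw [E.η_eq]
  split_ifs with h
  · rcases E.θ_eq (n + 1) with h' | h' <;> rw [h'] <;> exact h.sub_odd (by decide)
  · simpa using Int.not_odd_iff_even.1 h

/-- It supplies the hypothesis `k = 2 → c = -1` in the invariance of both regions. -/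
lemma g_mul_g (n : ℕ) (hn : |E.b n| = 2) : E.g n * E.g (n + 1) = -1 := by
  have h := E.X_mul_X_neg n hn
  rw [E.X_eq n, E.X_eq (n + 1)] at h
  rcases E.g_eq n with h1 | h1 <;> rcases E.g_eq (n + 1) with h2 | h2 <;> simp [h1, h2] at h ⊢
  · exact absurd h (not_lt.2 (by positivity))
  · exact absurd h (not_lt.2 (by positivity))

lemma θ_step (n : ℕ) : E.θ n * E.g n = if Odd |E.b n| then - E.θ (n + 1) else E.θ (n + 1) := by
  rw [E.θ_succ]
  unfold g
  simp only [odd_abs]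
  split_ifs <;> simp

lemma ρ_inv (n : ℕ) : |X (E.r n)|⁻¹ =
    ((|E.b n| : ℤ) : ℝ) - ((E.g n * E.g (n + 1) : ℤ) : ℝ) * |X (E.r (n + 1))| := by
  have h := congrArg X (E.r_succ n)
  rw [map_sub, map_intCast, map_inv₀, E.X_eq n, E.X_eq (n + 1)] at h
  have hb : ((E.b n : ℤ) : ℝ) = E.g n * ((|E.b n| : ℤ) : ℝ) := by exact_mod_cast E.b_eq n
  rw [hb] at h
  rcases E.g_eq n with h1 | h1 <;> simp only [h1, mul_inv] at h ⊢ <;> push_cast at h ⊢ <;>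
    norm_num at h ⊢ <;> linarith

lemma Y_succ (n : ℕ) : Y (E.r (n + 1)) =
    E.g n * (((|E.b n| : ℤ) : ℝ) - ((E.g n * E.h n : ℤ) : ℝ) * |Y (E.r n)|⁻¹) := by
  have h := congrArg Y (E.r_succ n)
  rw [map_sub, map_intCast, map_inv₀, E.Y_eq n] at h
  have hb : ((E.b n : ℤ) : ℝ) = E.g n * ((|E.b n| : ℤ) : ℝ) := by exact_mod_cast E.b_eq n
  rw [hb] at h
  rcases E.g_eq n with h1 | h1 <;> rcases E.h_eq n with h2 | h2 <;>
    simp only [h1, h2, mul_inv] at h ⊢ <;> push_cast at h ⊢ <;>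
    norm_num at h ⊢ <;> linarith

/-! ### Offsets lie in the regions up to a geometric error -/

section offset

variable {δ : ℕ → F}

/-- The `X`-coordinates of the offsets `δ` lie in the region `RegX`, up to an error which decreases
geometrically. -/
lemma exists_regX (hδ : ∀ n, δ (n + 1) = δ n / E.r n + E.η n) (K n : ℕ) :
    ∃ x, RegX |X (E.r n)| x ∧ |E.θ n * X (δ n) - x| ≤ (1 / 2) ^ K * |X (δ (n + K))| := by
  induction K generalizing n with
  | zero =>
    refine ⟨0, ⟨le_rfl, abs_nonneg _, E.abs_X_le n, by linarith [E.abs_X_le n]⟩, ?_⟩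
    rcases E.θ_eq n with h | h <;> simp [h]
  | succ K ih =>
    obtain ⟨x, hx, hxe⟩ := ih (n + 1)
    have hc : ((E.g n * E.g (n + 1) : ℤ) : ℝ) = 1 ∨ ((E.g n * E.g (n + 1) : ℤ) : ℝ) = -1 := by
      rcases E.g_eq n with h1 | h1 <;> rcases E.g_eq (n + 1) with h2 | h2 <;> simp [h1, h2]
    obtain ⟨-, hs⟩ := hx.step hc (E.two_le n) (fun h => by rw [E.g_mul_g n h]; simp)
    rw [← E.ρ_inv, inv_inv] at hs
    refine ⟨_, hs, ?_⟩
    -- With the sign `θ n`, solving the recursion for `δ n` becomes `x ↦ ρ(1 - x)` for odd and `x ↦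
    -- ρx` for even partial quotients, exactly the map of `RegX.step`.
    have hstep : E.θ n * X (δ n) = |X (E.r n)| *
        if Odd |E.b n| then 1 - E.θ (n + 1) * X (δ (n + 1)) else E.θ (n + 1) * X (δ (n + 1)) := by
      have e : X (δ n) = X (E.r n) * (X (δ (n + 1)) - E.η n) := by
        rw [hδ n, map_add, map_div₀, map_intCast]
        have := E.X_ne_zero n
        field_simp
        ring
      have e2 : (E.θ n : ℝ) * E.g n = if Odd |E.b n| then -(E.θ (n + 1) : ℝ) else E.θ (n + 1) := by
        exact_mod_cast E.θ_step n
      have e3 : (E.θ (n + 1) : ℝ) * E.θ (n + 1) = 1 := by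
        rcases E.θ_eq (n + 1) with h | h <;> simp [h]
      rw [e, E.X_eq n, abs_mul, E.η_eq]
      have e4 : |(E.g n : ℝ)| = 1 := by rcases E.g_eq n with h | h <;> simp [h]
      rw [e4, one_mul, abs_abs]
      have : ∀ w : ℝ, E.θ n * (E.g n * |X (E.r n)| * w) = |X (E.r n)| * (E.θ n * E.g n * w) :=
        fun w => by ring
      rw [this, e2]
      simp only [odd_abs]
      congr 1
      split_ifs
      · linear_combination e3
      · simp
    have habs : |E.θ n * X (δ n) - |X (E.r n)| * if Odd |E.b n| then 1 - x else x| =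
        |X (E.r n)| * |E.θ (n + 1) * X (δ (n + 1)) - x| := by
      rw [hstep, ← mul_sub, abs_mul, abs_abs]
      congr 1
      split_ifs
      · rw [← abs_neg]; congr 1; ring
      · rfl
    rw [habs, show n + (K + 1) = n + 1 + K by ring, pow_succ', mul_assoc]
    exact mul_le_mul (E.abs_X_le n) hxe (abs_nonneg _) (by norm_num)

/-- The `Y`-coordinates of the offsets `δ` lie in the region `RegY`, up to an error which decreases
geometrically. -/
lemma exists_regY (hδ : ∀ n, δ (n + 1) = δ n / E.r n + E.η n) (n : ℕ) :
    ∃ y, RegY ((E.g n * E.h n : ℤ) : ℝ) |Y (E.r n)|⁻¹ y ∧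
      |E.θ n * E.h n * (Y (δ n) / Y (E.r n)) - y| ≤ 0.6181 ^ n * |Y (δ 0) / Y (E.r 0)| := by
  induction n with
  | zero =>
    have h3 := E.three_le
    have h1 : |Y (E.r 0)|⁻¹ ≤ 1 / 3 := by
      rw [inv_le_comm₀ (by linarith) (by norm_num)]; linarith
    have h0 : 0 ≤ |Y (E.r 0)|⁻¹ := by positivity
    -- The start `y = 0` lies in `RegA` because `s ≤ 1/3`; this is the role of `three_le`.
    refine ⟨0, .inl ⟨h0, by linarith, by linarith, by linarith, by linarith, by linarith⟩, ?_⟩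
    rcases E.θ_eq 0 with h | h <;> rcases E.h_eq 0 with h' | h' <;> simp [h, h']
  | succ n ih =>
    obtain ⟨y, hy, hye⟩ := ih
    have hc : ((E.g n * E.h n : ℤ) : ℝ) = 1 ∨ ((E.g n * E.h n : ℤ) : ℝ) = -1 := by
      rcases E.g_eq n with h1 | h1 <;> rcases E.h_eq n with h2 | h2 <;> simp [h1, h2]
    have hpos := (hy.step (c' := -1) hc (E.two_le n) (fun _ => rfl)).1
    have hY := E.Y_succ n
    set D := ((|E.b n| : ℤ) : ℝ) - ((E.g n * E.h n : ℤ) : ℝ) * |Y (E.r n)|⁻¹ with hD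
    -- In the expanding direction the partial quotient dominates `1 / Y (r n)`, so it determines the
    -- sign of the next `Y`-value.
    have hh : E.h (n + 1) = E.g n := by
      rw [h, hY]
      rcases E.g_eq n with h1 | h1
      · simp [h1, hpos]
      · simp [h1, hpos.le]
    have hYabs : |Y (E.r (n + 1))| = D := by
      rw [hY, abs_mul, abs_of_pos hpos]
      rcases E.g_eq n with h1 | h1 <;> simp [h1]
    have hflag : |E.b n| = 2 → ((E.g (n + 1) * E.h (n + 1) : ℤ) : ℝ) = -1 := by
      intro hb
      rw [hh, mul_comm, E.g_mul_g n hb]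
      simp
    obtain ⟨-, hs⟩ := hy.step hc (E.two_le n) hflag
    rw [← hD, ← hYabs] at hs
    have hσ := hs.le.2.1
    refine ⟨_, hs, ?_⟩
    set v := Y (δ n) / Y (E.r n) with hv
    have hstep : E.θ (n + 1) * E.h (n + 1) * (Y (δ (n + 1)) / Y (E.r (n + 1))) =
        |Y (E.r (n + 1))|⁻¹ * if Odd |E.b n| then
          1 - ((E.g n * E.h n : ℤ) : ℝ) * (E.θ n * E.h n * v)
          else ((E.g n * E.h n : ℤ) : ℝ) * (E.θ n * E.h n * v) := by
      have e : Y (δ (n + 1)) = v + E.η n := by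
        rw [hδ n, map_add, map_div₀, map_intCast]
      have e2 : (E.θ n : ℝ) * E.g n = if Odd |E.b n| then -(E.θ (n + 1) : ℝ) else E.θ (n + 1) := by
        exact_mod_cast E.θ_step n
      have e3 : (E.θ (n + 1) : ℝ) * E.θ (n + 1) = 1 := by
        rcases E.θ_eq (n + 1) with h | h <;> simp [h]
      have e4 : (E.g n : ℝ) * E.g n = 1 := by
        rcases E.g_eq n with h | h <;> simp [h]
      have e5 : (E.h n : ℝ) * E.h n = 1 := by
        rcases E.h_eq n with h | h <;> simp [h]
      have e6 : (E.g n : ℝ) / (E.g n * D) = D⁻¹ := by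
        have : (E.g n : ℝ) ≠ 0 := fun h => by simp [h] at e4
        field_simp
      have e7 : ((E.g n * E.h n : ℤ) : ℝ) * (E.θ n * E.h n * v) =
          (if Odd |E.b n| then -(E.θ (n + 1) : ℝ) else E.θ (n + 1)) * v := by
        rw [← e2]; push_cast; linear_combination (E.g n * E.θ n * v : ℝ) * e5
      rw [e7, hYabs, e, hh, hY, ← e6, E.η_eq]
      simp only [odd_abs]
      split_ifs
      · rw [mul_div_assoc', div_mul_eq_mul_div]
        congr 1
        linear_combination (E.g n : ℝ) * e3
      · push_cast; ring
    have habs : |E.θ (n + 1) * E.h (n + 1) * (Y (δ (n + 1)) / Y (E.r (n + 1))) -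
        |Y (E.r (n + 1))|⁻¹ * if Odd |E.b n| then 1 - ((E.g n * E.h n : ℤ) : ℝ) * y
          else ((E.g n * E.h n : ℤ) : ℝ) * y| =
        |Y (E.r (n + 1))|⁻¹ * |E.θ n * E.h n * v - y| := by
      rw [hstep, ← mul_sub, abs_mul, abs_of_nonneg hs.le.1]
      congr 1
      rcases hc with h | h <;> rw [h] <;> split_ifs <;>
        first
        | (congr 1; ring1)
        | (rw [← abs_neg]; congr 1; ring1)
    rw [habs]
    exact (mul_le_mul hσ hye (abs_nonneg _) (by norm_num)).trans_eq (by ring)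

end offset

end SignedExpansion

lemma mem_of_isClosed_of_abs_sub_le {s : Set ℝ} (hs : IsClosed s) {a : ℝ} {u : ℕ → ℝ}
    (hu : Filter.Tendsto u Filter.atTop (nhds 0)) (h : ∀ j, ∃ x ∈ s, |a - x| ≤ u j) : a ∈ s := by
  rw [← hs.closure_eq, Metric.mem_closure_iff]
  intro ε hε
  obtain ⟨j, hj⟩ := (hu.eventually_lt_const hε).exists
  obtain ⟨x, hx, hxj⟩ := h j
  exact ⟨x, hx, hxj.trans_lt hj⟩

/-- Both factors are bounded below, by 1.1 and 0.68, since `|T|` is at most `|S|` and `|R|`. The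
left side is at most linear in them, because `T * W` is their sum up to an error of at most `1.86 =
1 + 0.4 + 0.46`. -/
lemma abs_mul_abs_ge_of_three_le {S R T ρ x s y b η : ℝ} (hS : 3 ≤ |S|) (hR : 3 ≤ |R|)
    (hT : 1 ≤ |T|) (hTS : |T| ≤ |S|) (hTR : |T| ≤ |R|) (h : R = b * T - S - η) (hρ : |ρ| ≤ 0.5)
    (hx : |x| ≤ 0.4) (hs : |s| ≤ 0.6181) (hy : |y| ≤ 0.46) (hη : |η| ≤ 1) :
    0.1304 * |b - s - ρ| ≤ |S - T * ρ + x| * |R - T * s - y| := by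
  set W := b - s - ρ with hW
  set A := S - T * ρ + x with hA
  set B := R - T * s - y with hB
  have hTρ : |T * ρ| ≤ |T| * 0.5 := by rw [abs_mul]; gcongr
  have hTs : |T * s| ≤ |T| * 0.6181 := by rw [abs_mul]; gcongr
  have h1 : |S| ≤ |A| + |T * ρ| + |x| := by
    have : S = A + T * ρ - x := by rw [hA]; ring
    calc |S| = |A + T * ρ - x| := by rw [← this]
      _ ≤ |A + T * ρ| + |x| := abs_sub _ _
      _ ≤ _ := by gcongr; exact abs_add_le _ _
  have h2 : |R| ≤ |B| + |T * s| + |y| := by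
    have : R = B + T * s + y := by rw [hB]; ring
    calc |R| = |B + T * s + y| := by rw [← this]
      _ ≤ |B + T * s| + |y| := abs_add_le _ _
      _ ≤ _ := by gcongr; exact abs_add_le _ _
  have h3 : |W| ≤ |A| + |B| + 1.86 := by
    have : T * W = A + B + η + (y - x) := by rw [hA, hB, hW, h]; ring
    calc |W| ≤ |T| * |W| := le_mul_of_one_le_left (abs_nonneg _) hT
      _ = |A + B + η + (y - x)| := by rw [← this, abs_mul]
      _ ≤ |A| + |B| + |η| + (|y| + |x|) :=
        (abs_add_le _ _).trans (add_le_add ((abs_add_le _ _).trans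
          (add_le_add (abs_add_le _ _) le_rfl)) (abs_sub _ _))
      _ ≤ _ := by linarith
  have hA1 : 1.1 ≤ |A| := by linarith
  have hB1 : 0.68 ≤ |B| := by linarith
  nlinarith [mul_nonneg (sub_nonneg.2 hA1) (sub_nonneg.2 hB1)]

/-! ### Periodic offsets and descent to the vertices of cells -/

namespace SignedExpansion

variable {F : Type*} [Field F] {X Y : F →+* ℝ} (E : SignedExpansion X Y)

/-- A sequence `δ` of offsets of the expansion, with `E` and `δ` periodic of period `p` from the
index `N` on. -/
structure IsPeriodicOffset (δ : ℕ → F) (N p : ℕ) : Prop where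
  pos : 0 < p
  succ : ∀ n, δ (n + 1) = δ n / E.r n + E.η n
  r_add : ∀ n, N ≤ n → E.r (n + p) = E.r n
  θ_add : ∀ n, N ≤ n → E.θ (n + p) = E.θ n
  add : ∀ n, N ≤ n → δ (n + p) = δ n

/-- The point with coordinates `S`, `-T` relative to the cell of index `n` has large norm. -/
def IsFar (δ : ℕ → F) (n : ℕ) (S T : ℤ) : Prop :=
  0.1304 * |X (E.r n) - Y (E.r n)| ≤
    |X (δ n + S - T * E.r n)| * |Y (δ n + S - T * E.r n)|

variable {E} {δ : ℕ → F} {N p : ℕ}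

namespace IsPeriodicOffset

variable (P : E.IsPeriodicOffset δ N p)

include P

lemma add_mul {n : ℕ} (hn : N ≤ n) (j : ℕ) :
    E.r (n + p * j) = E.r n ∧ E.θ (n + p * j) = E.θ n ∧ δ (n + p * j) = δ n := by
  induction j with
  | zero => simp
  | succ j ih =>
    have hn' : N ≤ n + p * j := by omega
    rw [mul_add, mul_one, ← add_assoc, P.r_add _ hn', P.θ_add _ hn', P.add _ hn']
    exact ih

/-- Looking `p * j` steps ahead returns to the same offset, so the error tends to 0 as `j` grows,
and the region is closed. -/
lemma regX {n : ℕ} (hn : N ≤ n) : RegX |X (E.r n)| (E.θ n * X (δ n)) := by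
  refine mem_of_isClosed_of_abs_sub_le (isClosed_regX _)
    (u := fun j => (1 / 2) ^ (p * j) * |X (δ n)|) ?_ ?_
  · have h : Filter.Tendsto (fun j : ℕ => ((1 / 2 : ℝ) ^ p) ^ j) Filter.atTop (nhds 0) :=
      tendsto_pow_atTop_nhds_zero_of_lt_one (by positivity)
        (pow_lt_one₀ (by norm_num) (by norm_num) P.pos.ne')
    simpa [pow_mul] using h.mul_const |X (δ n)|
  · intro j
    obtain ⟨x, hx, hxj⟩ := E.exists_regX P.succ (p * j) n
    rw [(P.add_mul hn j).2.2] at hxj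
    exact ⟨x, hx, hxj⟩

/-- As in `regX`, but the forward iteration from index 0 is evaluated at `n + p * j`, where
expansion and offset agree with those at `n`. -/
lemma regY {n : ℕ} (hn : N ≤ n) : RegY ((E.g n * E.h n : ℤ) : ℝ) |Y (E.r n)|⁻¹
    (E.θ n * E.h n * (Y (δ n) / Y (E.r n))) := by
  refine mem_of_isClosed_of_abs_sub_le (isClosed_regY _ _)
    (u := fun j => 0.6181 ^ (n + p * j) * |Y (δ 0) / Y (E.r 0)|) ?_ ?_
  · have h : Filter.Tendsto (fun j : ℕ => ((0.6181 : ℝ) ^ p) ^ j) Filter.atTop (nhds 0) :=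
      tendsto_pow_atTop_nhds_zero_of_lt_one (by positivity)
        (pow_lt_one₀ (by norm_num) (by norm_num) P.pos.ne')
    simpa [pow_mul, pow_add] using (h.const_mul (0.6181 ^ n)).mul_const |Y (δ 0) / Y (E.r 0)|
  · intro j
    obtain ⟨y, hy, hyj⟩ := E.exists_regY P.succ (n + p * j)
    obtain ⟨h1, h2, h3⟩ := P.add_mul hn j
    have hh : E.h (n + p * j) = E.h n := by unfold h; rw [h1]
    have hg : E.g (n + p * j) = E.g n := by
      have e1 := E.X_eq (n + p * j)
      rw [h1] at e1
      have e2 := e1.symm.trans (E.X_eq n)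
      exact_mod_cast mul_right_cancel₀ (abs_ne_zero.2 (E.X_ne_zero n)) e2
    rw [hh, hg, h1] at hy
    rw [hh, h1, h2, h3] at hyj
    exact ⟨y, hy, hyj⟩

/-- Both sides of the inequality are multiplied by `|X (r n) * Y (r n)|` when the point of the next
cell is multiplied by `r n`. -/
lemma isFar_succ (n : ℕ) (S T : ℤ) :
    E.IsFar δ n S T ↔ E.IsFar δ (n + 1) (E.b n * S - T - E.η n) S := by
  have hr := E.r_ne_zero n
  have h1 : δ n + S - T * E.r n = E.r n *
      (δ (n + 1) + ((E.b n * S - T - E.η n : ℤ) : F) - S * E.r (n + 1)) := by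
    rw [P.succ, E.r_succ]
    push_cast
    field_simp
    ring
  have hX := E.X_ne_zero n
  have hY := E.Y_ne_zero n
  have h2 : X (E.r n) - Y (E.r n) =
      X (E.r n) * Y (E.r n) * (X (E.r (n + 1)) - Y (E.r (n + 1))) := by
    rw [E.r_succ]
    simp only [map_sub, map_intCast, map_inv₀]
    field_simp
    ring
  unfold IsFar
  rw [h1, h2, map_mul, map_mul, abs_mul, abs_mul, abs_mul, abs_mul]
  have hpos : 0 < |X (E.r n)| * |Y (E.r n)| := by positivity
  rw [show ∀ u v w z : ℝ, u * v * (w * z) = u * w * (v * z) by intros; ring,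
    show ∀ u v : ℝ, 0.1304 * (u * v) = u * (0.1304 * v) by intros; ring]
  exact mul_le_mul_iff_of_pos_left hpos

lemma isFar_add {n : ℕ} (hn : N ≤ n) (S T : ℤ) :
    E.IsFar δ (n + p) S T ↔ E.IsFar δ n S T := by
  unfold IsFar
  rw [P.r_add n hn, P.add n hn]

/-- The vertex case. The signs `g`, `h`, `θ` reduce it to `RegX.vertex_le` with `c = g h`, `m = S T
g`, `k = S θ`. -/
lemma isFar_of_abs_eq_one {n : ℕ} (hn : N ≤ n) {S T : ℤ} (hS : |S| = 1) (hT : |T| = 1) :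
    E.IsFar δ n S T := by
  have unit : ∀ {z : ℤ}, (z = 1 ∨ z = -1) → ((z : ℝ) = 1 ∨ (z : ℝ) = -1) := by
    rintro z (rfl | rfl) <;> simp
  have sq : ∀ {z : ℤ}, (z = 1 ∨ z = -1) → (z : ℝ) * z = 1 := by
    rintro z (rfl | rfl) <;> simp
  have mul : ∀ {z w : ℤ}, (z = 1 ∨ z = -1) → (w = 1 ∨ w = -1) → (z * w = 1 ∨ z * w = -1) := by
    rintro z w (rfl | rfl) (rfl | rfl) <;> simp
  have hS' : S = 1 ∨ S = -1 := (abs_eq zero_le_one).1 hS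
  have hT' : T = 1 ∨ T = -1 := (abs_eq zero_le_one).1 hT
  have hg := E.g_eq n
  have hh := E.h_eq n
  have hθ := E.θ_eq n
  have key := (P.regX hn).vertex_le (P.regY hn) (unit (mul hg hh))
    (unit (mul (mul hS' hT') hg)) (unit (mul hS' hθ))
  have sS := sq hS'
  have sT := sq hT'
  have sg := sq hg
  have sh := sq hh
  have sθ := sq hθ
  have absS : |(S : ℝ)| = 1 := by exact_mod_cast hS
  have absT : |(T : ℝ)| = 1 := by exact_mod_cast hT
  have hY := E.Y_ne_zero n
  have hYi : |Y (E.r n)|⁻¹ * Y (E.r n) = E.h n := by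
    rw [E.Y_eq n]
    have : |Y (E.r n)| ≠ 0 := abs_ne_zero.2 hY
    rw [abs_mul, abs_abs]
    rcases hh with h | h <;> simp [h, this]
  have hX := E.X_eq n
  set P' := |X (E.r n)| with hP'
  set s := |Y (E.r n)|⁻¹ with hs
  set v := Y (δ n) / Y (E.r n) with hv
  have hv' : Y (δ n) = v * Y (E.r n) := by rw [hv]; field_simp
  unfold IsFar
  have e1 : |X (δ n + S - T * E.r n)| = |1 - ((S * T * E.g n : ℤ) : ℝ) * P' +
      ((S * E.θ n : ℤ) : ℝ) * (E.θ n * X (δ n))| := by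
    have : ∀ w : ℝ, |w| = |S * w| := fun w => by rw [abs_mul, absS, one_mul]
    rw [this]
    congr 1
    simp only [map_sub, map_add, map_mul, map_intCast, hX]
    push_cast
    linear_combination sS - S * X (δ n) * sθ
  have e2 : |Y (δ n + S - T * E.r n)| = |Y (E.r n)| *
      |1 - ((E.g n * E.h n : ℤ) : ℝ) * ((S * T * E.g n : ℤ) : ℝ) * s -
        ((S * E.θ n : ℤ) : ℝ) * ((S * T * E.g n : ℤ) : ℝ) * ((E.g n * E.h n : ℤ) : ℝ) *
          (E.θ n * E.h n * v)| := by
    have : ∀ w : ℝ, |w| = |-(T * w)| := fun w => by rw [abs_neg, abs_mul, absT, one_mul]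
    rw [← abs_mul, this]
    congr 1
    simp only [map_sub, map_add, map_mul, map_intCast, hv']
    push_cast
    have sY : S * T * (s * Y (E.r n) * E.h n) = S * T := by
      rw [hYi, sh, mul_one]
    have a1 : (E.g n * E.h n : ℝ) * (S * T * E.g n) * s * Y (E.r n) = S * T := by
      linear_combination sY + (S * T * s * Y (E.r n) * E.h n : ℝ) * sg
    have a2 : (S * E.θ n : ℝ) * (S * T * E.g n) * (E.g n * E.h n) * (E.θ n * E.h n * v) =
        T * v := by
      calc (S * E.θ n : ℝ) * (S * T * E.g n) * (E.g n * E.h n) * (E.θ n * E.h n * v)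
          = (S * S : ℝ) * (E.θ n * E.θ n) * (E.g n * E.g n) * (E.h n * E.h n) * (T * v) := by ring
        _ = T * v := by rw [sS, sθ, sg, sh]; ring
    linear_combination Y (E.r n) * sT + a1 + Y (E.r n) * a2
  have e3 : |X (E.r n) - Y (E.r n)| = |Y (E.r n)| *
      |1 - ((E.g n * E.h n : ℤ) : ℝ) * P' * s| := by
    rw [← abs_mul, ← abs_neg (X _ - _)]
    congr 1
    push_cast
    rw [hX]
    have : s * Y (E.r n) * E.h n = 1 := by rw [hYi, sh]
    linear_combination (E.g n * P' : ℝ) * this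
  rw [e1, e2, e3]
  have hpos := abs_nonneg (Y (E.r n))
  nlinarith [mul_le_mul_of_nonneg_left key hpos]

/-- The numbers `R`, `T`, `S` are consecutive coordinates of the same point, with `|T|` a local
minimum. If `|S| = 1` the point is a vertex of cell `n + 1`, and if `|R| = 1` a vertex of cell `n`;
otherwise oddness makes both at least 3 in absolute value. -/
lemma isFar_of_le {n : ℕ} (hn : N ≤ n) {S T : ℤ} (hS : Odd S) (hT : Odd T) (hTS : |T| ≤ |S|)
    (hTR : |T| ≤ |E.b n * T - S - E.η n|) : E.IsFar δ (n + 1) S T := by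
  set R := E.b n * T - S - E.η n with hR
  have hS' : S = E.b n * T - R - E.η n := by rw [hR]; ring
  have hodd : Odd R := by
    have h1 : R = (E.b n - E.η n) * T - S + E.η n * (T - 1) := by rw [hR]; ring
    rw [h1]
    exact (((E.even_b_sub_η n).mul_right T).sub_odd hS).add_even
      ((hT.sub_odd odd_one).mul_left _)
  have cases : ∀ {z : ℤ}, Odd z → |z| = 1 ∨ 3 ≤ |z| := by
    rintro z ⟨w, rfl⟩
    rcases abs_cases (2 * w + 1) with h | h <;> omega
  rcases cases hS with hS1 | hS3
  · refine P.isFar_of_abs_eq_one (by omega) hS1 ?_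
    rcases cases hT with h | h <;> omega
  rcases cases hodd with hR1 | hR3
  · rw [hS', ← P.isFar_succ]
    refine P.isFar_of_abs_eq_one hn ?_ hR1
    rcases cases hT with h | h <;> omega
  have hT1 : 1 ≤ |T| := by rcases cases hT with h | h <;> omega
  have rX := (P.regX (show N ≤ n + 1 by omega)).le
  have rX0 := P.regX (show N ≤ n + 1 by omega)
  have rY := (P.regY hn).le
  have absθ : ∀ m, |(E.θ m : ℝ)| = 1 := fun m => by
    rcases E.θ_eq m with h | h <;> simp [h]
  have absh : ∀ m, |(E.h m : ℝ)| = 1 := fun m => by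
    rcases E.h_eq m with h | h <;> simp [h]
  have hY := E.Y_ne_zero n
  have main := abs_mul_abs_ge_of_three_le (S := S) (R := R) (T := T) (ρ := X (E.r (n + 1)))
    (x := X (δ (n + 1))) (s := (Y (E.r n))⁻¹) (y := Y (δ n) / Y (E.r n)) (b := E.b n)
    (η := E.η n) (by exact_mod_cast hS3) (by exact_mod_cast hR3) (by exact_mod_cast hT1)
    (by exact_mod_cast hTS) (by exact_mod_cast hTR) (by rw [hR]; push_cast; ring)
    (by have := E.abs_X_le (n + 1); linarith)
    (by
      have := rX.2.1
      rwa [← abs_of_nonneg rX0.1, abs_mul, absθ, one_mul] at this)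
    (by rw [abs_inv]; exact rY.2.1)
    (by
      have := rY.2.2
      rwa [abs_mul, abs_mul, absθ, absh, one_mul, one_mul] at this)
    (by exact_mod_cast E.abs_η_le n)
  unfold IsFar
  have e1 : Y (E.r (n + 1)) = E.b n - (Y (E.r n))⁻¹ := by
    rw [E.r_succ]; simp
  have e2 : Y (δ (n + 1)) = Y (δ n) / Y (E.r n) + E.η n := by
    rw [P.succ]; simp
  have e3 : |X (E.r (n + 1)) - Y (E.r (n + 1))| = |E.b n - (Y (E.r n))⁻¹ - X (E.r (n + 1))| := by
    rw [e1, ← abs_neg]; congr 1; ring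
  have e4 : |Y (δ (n + 1) + S - T * E.r (n + 1))| =
      |R - T * (Y (E.r n))⁻¹ - Y (δ n) / Y (E.r n)| := by
    rw [← abs_neg]
    congr 1
    simp only [map_sub, map_add, map_mul, map_intCast, e1, e2, hR]
    push_cast
    ring
  have e5 : X (δ (n + 1) + S - T * E.r (n + 1)) = S - T * X (E.r (n + 1)) + X (δ (n + 1)) := by
    simp only [map_sub, map_add, map_mul, map_intCast]
    ring
  rw [e3, e4, e5]
  exact main

/-- Descent on `|S| + |T|`: moving to the next or previous cell replaces the larger coordinate, and
either the sum drops or a local minimum has been reached. -/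
lemma isFar_of_natAbs {m n : ℕ} (hn : N ≤ n) {S T : ℤ} (hS : Odd S) (hT : Odd T)
    (hm : S.natAbs + T.natAbs = m) : E.IsFar δ n S T := by
  induction m using Nat.strong_induction_on generalizing n S T with
  | _ m ih =>
  have odd : ∀ k {S T : ℤ}, Odd S → Odd T → Odd (E.b k * S - T - E.η k) := by
    intro k S T hS hT
    have h1 : E.b k * S - T - E.η k = (E.b k - E.η k) * S - T + E.η k * (S - 1) := by ring
    rw [h1]
    exact (((E.even_b_sub_η k).mul_right S).sub_odd hT).add_even
      ((hS.sub_odd odd_one).mul_left _)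
  rcases le_or_gt |S| |T| with hST | hST
  · rw [P.isFar_succ]
    have hodd := odd n hS hT
    rcases lt_or_ge |E.b n * S - T - E.η n| |T| with h | h
    · refine ih _ ?_ (by omega) hodd hS rfl
      simp only [Int.abs_eq_natAbs] at h
      omega
    · refine P.isFar_of_le hn hodd hS (hST.trans h) ?_
      rwa [show E.b n * S - (E.b n * S - T - E.η n) - E.η n = T by ring]
  · have hp := P.pos
    -- Adding a period first keeps the preceding index in the periodic range.
    obtain ⟨n', hn'⟩ : ∃ n', n + p = n' + 1 := ⟨n + p - 1, by omega⟩
    have hNn' : N ≤ n' := by omega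
    rw [← P.isFar_add hn, hn']
    have hodd := odd n' hT hS
    rcases lt_or_ge |E.b n' * T - S - E.η n'| |S| with h | h
    · have := P.isFar_succ n' T (E.b n' * T - S - E.η n')
      rw [show E.b n' * T - (E.b n' * T - S - E.η n') - E.η n' = S by ring] at this
      rw [← this]
      refine ih _ ?_ hNn' hT hodd rfl
      simp only [Int.abs_eq_natAbs] at h
      omega
    · exact P.isFar_of_le hNn' hS hT hST.le (hST.le.trans h)

/-- All the points of the grid are far from the axes. -/
theorem isFar (n : ℕ) {S T : ℤ} (hS : Odd S) (hT : Odd T) : E.IsFar δ n S T := by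
  obtain ⟨k, hk⟩ : ∃ k, N ≤ n + k := ⟨N, by omega⟩
  induction k generalizing n S T with
  | zero => exact P.isFar_of_natAbs hk hS hT rfl
  | succ k ih =>
    rw [P.isFar_succ]
    refine ih _ ?_ hS (by omega)
    have h1 : E.b n * S - T - E.η n = (E.b n - E.η n) * S - T + E.η n * (S - 1) := by ring
    rw [h1]
    exact (((E.even_b_sub_η n).mul_right S).sub_odd hT).add_even
      ((hS.sub_odd odd_one).mul_left _)

end IsPeriodicOffset

end SignedExpansion

/-! ### Reduced elements, periodicity and the distant point -/

section orbit

variable {F : Type*} [Field F] (X Y : F →+* ℝ)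

/-- One step of the nearest integer expansion, with its sign. -/
noncomputable def expansionStep (a : F × ℤ) : F × ℤ :=
  (((round (X a.1)⁻¹ : ℤ) : F) - a.1⁻¹,
    if Odd (round (X a.1)⁻¹) then -(a.2 * (round (X a.1)⁻¹).sign)
    else a.2 * (round (X a.1)⁻¹).sign)

/-- The element `x` is a root of an integral quadratic polynomial of discriminant `D`, and is reduced
with respect to the embeddings `X` and `Y`. -/
def IsReduced (D : ℤ) (x : F) : Prop :=
  |X x| ≤ 1 / 2 ∧ 1 < |Y x| ∧
    ∃ A B C : ℤ, (A : F) * x ^ 2 + B * x + C = 0 ∧ B ^ 2 - 4 * A * C = D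

variable {X Y} {D : ℤ} {x : F}

lemma IsReduced.map_ne_zero (h : IsReduced X Y D x) : X x ≠ 0 := by
  intro h0
  have : x = 0 := by simpa using h0
  have h1 := h.2.1
  simp [this] at h1
  linarith

lemma IsReduced.two_le_round (h : IsReduced X Y D x) :
    2 ≤ |round (X x)⁻¹| ∧ 0 < round (X x)⁻¹ * X x ∧
      |round (X x)⁻¹ - (X x)⁻¹| ≤ 1 / 2 := by
  have h0 := h.map_ne_zero
  have h1 : 2 ≤ |(X x)⁻¹| := by
    rw [abs_inv, le_inv_comm₀ (by norm_num) (by positivity)]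
    linarith [h.1]
  have h2 := abs_sub_round (X x)⁻¹
  rw [abs_sub_comm] at h2
  have h3 := abs_le.1 h2
  refine ⟨?_, ?_, h2⟩
  · have h4 : (1 : ℝ) < |((round (X x)⁻¹ : ℤ) : ℝ)| := by
      rcases abs_cases (X x)⁻¹ with h | h <;>
        rcases abs_cases ((round (X x)⁻¹ : ℤ) : ℝ) with h' | h' <;> linarith
    have h5 : (1 : ℤ) < |round (X x)⁻¹| := by exact_mod_cast h4
    omega
  · have h4 : X x * (X x)⁻¹ = 1 := mul_inv_cancel₀ h0
    rcases lt_or_gt_of_ne h0 with hx | hx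
    · have := inv_lt_zero.2 hx
      rw [abs_of_neg this] at h1
      exact mul_pos_of_neg_of_neg (by linarith) hx
    · have := inv_pos.2 hx
      rw [abs_of_pos this] at h1
      exact mul_pos (by linarith) hx

lemma IsReduced.step (h : IsReduced X Y D x) :
    IsReduced X Y D (((round (X x)⁻¹ : ℤ) : F) - x⁻¹) := by
  obtain ⟨h1, h2, h3⟩ := h.two_le_round
  have hx : x ≠ 0 := fun h0 => h.map_ne_zero (by simp [h0])
  obtain ⟨-, hY, A, B, C, hx2, hD⟩ := h
  set b := round (X x)⁻¹
  refine ⟨by simpa using h3, ?_, C, -(2 * b * C + B), A + B * b + C * b ^ 2, ?_, ?_⟩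
  · have h4 : |Y x|⁻¹ < 1 := inv_lt_one_of_one_lt₀ hY
    have h5 : (2 : ℝ) ≤ |(b : ℝ)| := by exact_mod_cast h1
    have h6 := abs_sub_abs_le_abs_sub (b : ℝ) (Y x)⁻¹
    rw [abs_inv] at h6
    rw [map_sub, map_intCast, map_inv₀]
    linarith
  · push_cast
    field_simp
    linear_combination hx2
  · rw [← hD]; ring

/-- The discriminant is `D = (A (X x - Y x))²`, and being reduced keeps `|X x - Y x|` above `1/2`,
which bounds all three coefficients. -/
lemma IsReduced.bounds (h : IsReduced X Y D x) (hD : 0 < D) :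
    ∃ A B C : ℤ, (A : F) * x ^ 2 + B * x + C = 0 ∧ A ≠ 0 ∧ |A| ≤ 3 * D ∧ |B| ≤ 3 * D ∧
      |C| ≤ 3 * D := by
  obtain ⟨h1, h2, A, B, C, hx, hABC⟩ := h
  have hXx := congrArg X hx
  have hYx := congrArg Y hx
  simp only [map_add, map_mul, map_pow, map_intCast, map_zero] at hXx hYx
  have hne : X x - Y x ≠ 0 := fun h0 => by
    rw [sub_eq_zero] at h0
    rw [h0] at h1
    linarith
  have hsum : (B : ℝ) = -A * (X x + Y x) := by
    have : (X x - Y x) * (A * (X x + Y x) + B) = 0 := by linear_combination hXx - hYx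
    have := (mul_eq_zero.1 this).resolve_left hne
    linarith
  have hprod : (C : ℝ) = A * (X x * Y x) := by
    rw [hsum] at hXx
    linear_combination hXx
  have hdisc : (A * (X x - Y x)) ^ 2 = (D : ℝ) := by
    rw [← hABC]
    push_cast
    rw [hsum, hprod]
    ring
  have hD1 : (1 : ℝ) ≤ D := by exact_mod_cast hD
  have hA : A ≠ 0 := by
    rintro rfl
    simp at hdisc
    linarith
  have hle : |(A : ℝ)| * |X x - Y x| ≤ D := by
    rw [← abs_mul]
    refine abs_le_of_sq_le_sq ?_ (by linarith)
    rw [hdisc]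
    nlinarith
  have hXY : |Y x| - 1 / 2 ≤ |X x - Y x| := by
    have := abs_sub_abs_le_abs_sub (Y x) (X x)
    rw [abs_sub_comm] at this
    linarith
  have hA0 := abs_nonneg (A : ℝ)
  refine ⟨A, B, C, hx, hA, ?_, ?_, ?_⟩
  · have : |(A : ℝ)| ≤ 3 * D := by nlinarith
    exact_mod_cast this
  · have : |(B : ℝ)| ≤ 3 * D := by
      rw [hsum, abs_mul, abs_neg]
      have := abs_add_le (X x) (Y x)
      have : |X x + Y x| ≤ 3 * |X x - Y x| := by linarith
      nlinarith
    exact_mod_cast this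
  · have : |(C : ℝ)| ≤ 3 * D := by
      rw [hprod, abs_mul, abs_mul]
      have : |X x| * |Y x| ≤ 1 / 2 * |Y x| := by gcongr
      have : |X x| * |Y x| ≤ 3 * |X x - Y x| := by linarith
      nlinarith
    exact_mod_cast this

lemma finite_setOf_isReduced [CharZero F] (hD : 0 < D) : {x : F | IsReduced X Y D x}.Finite := by
  let I := Set.Icc (-(3 * D)) (3 * D)
  have hI : I.Finite := Set.finite_Icc _ _
  have hfin : (⋃ a ∈ I \ {0}, ⋃ b ∈ I, ⋃ c ∈ I,
      {x : F | (a : F) * x ^ 2 + b * x + c = 0}).Finite := by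
    refine (hI.subset Set.sdiff_subset).biUnion fun a ha => hI.biUnion fun b _ =>
      hI.biUnion fun c _ => ?_
    have ha' : (a : F) ≠ 0 := by exact_mod_cast ha.2
    let P : Polynomial F := .C (a : F) * .X ^ 2 + .C (b : F) * .X + .C (c : F)
    have hP : P ≠ 0 := fun h => by
      have := Polynomial.degree_quadratic (b := (b : F)) (c := (c : F)) ha'
      rw [show Polynomial.C (a : F) * .X ^ 2 + .C (b : F) * .X + .C (c : F) = 0 from h] at this
      simp at this
    refine (Polynomial.finite_setOfPred_isRoot hP).subset fun x hx => ?_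
    simpa [P, Polynomial.IsRoot] using hx
  refine hfin.subset fun x hx => ?_
  obtain ⟨A, B, C, h1, h2, h3, h4, h5⟩ := IsReduced.bounds hx hD
  simp only [Set.mem_iUnion]
  exact ⟨A, ⟨abs_le.1 h3, h2⟩, B, abs_le.1 h4, C, abs_le.1 h5, h1⟩

/-- A sufficiently expanded reduced element starts a nearest integer expansion, which is
eventually periodic. -/
lemma exists_signedExpansion [CharZero F] (hD : 0 < D) (hx : IsReduced X Y D x) (h3 : 3 ≤ |Y x|) :
    ∃ (E : SignedExpansion X Y) (N p : ℕ), E.r 0 = x ∧ 0 < p ∧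
      ∀ n, N ≤ n → E.r (n + p) = E.r n ∧ E.θ (n + p) = E.θ n := by
  let st : ℕ → F × ℤ := fun n => (expansionStep X)^[n] (x, 1)
  have st_succ : ∀ n, st (n + 1) = expansionStep X (st n) := fun n =>
    Function.iterate_succ_apply' _ _ _
  have hred : ∀ n, IsReduced X Y D (st n).1 := by
    intro n
    induction n with
    | zero => exact hx
    | succ n ih => rw [st_succ]; exact ih.step
  let E : SignedExpansion X Y :=
    { r := fun n => (st n).1
      b := fun n => round (X (st n).1)⁻¹
      θ := fun n => (st n).2
      r_succ := fun n => by rw [st_succ]; rfl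
      abs_X_le := fun n => (hred n).1
      b_mul_X_pos := fun n => (hred n).two_le_round.2.1
      two_le := fun n => (hred n).two_le_round.1
      X_mul_X_neg := fun n hn => by
        have h1 := (hred n).map_ne_zero
        have h2 := (hred (n + 1)).map_ne_zero
        have h3 := (hred n).1
        have h4 := (hred n).two_le_round.2.1
        rw [st_succ] at h2 ⊢
        simp only [expansionStep, map_sub, map_intCast, map_inv₀] at h2 ⊢
        set b := round (X (st n).1)⁻¹
        -- The product equals `b * X (r n) - 1`, which is not positive since `|b| = 2` and `|X (r
        -- n)| ≤ 1/2`.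
        refine lt_of_le_of_ne ?_ (mul_ne_zero h1 h2)
        rw [mul_sub, mul_inv_cancel₀ h1]
        have h5 : |(b : ℝ)| = 2 := by exact_mod_cast hn
        have h6 : X (st n).1 * b ≤ |X (st n).1| * |(b : ℝ)| := by
          rw [← abs_mul]; exact le_abs_self _
        rw [h5] at h6
        linarith
      θ_zero := rfl
      θ_succ := fun n => by rw [st_succ]; rfl
      three_le := h3 }
  have hmem : ∀ n, st n ∈ {x : F | IsReduced X Y D x} ×ˢ ({1, -1} : Set ℤ) := fun n =>
    ⟨hred n, by simpa using E.θ_eq n⟩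
  -- Pigeonhole on pairs (reduced element of discriminant `D`, sign).
  obtain ⟨N, M, hNM, heq⟩ := Set.Finite.exists_lt_map_eq_of_forall_mem hmem
    ((finite_setOf_isReduced hD).prod (by simp))
  have hper : ∀ k, st (N + k + (M - N)) = st (N + k) := by
    intro k
    induction k with
    | zero => rw [add_zero, heq]; congr 1; omega
    | succ k ih =>
      rw [show N + (k + 1) + (M - N) = N + k + (M - N) + 1 by omega, st_succ, ih, ← st_succ]
      rfl
  refine ⟨E, N, M - N, rfl, by omega, fun n hn => ?_⟩
  obtain ⟨k, rfl⟩ := Nat.exists_eq_add_of_le hn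
  exact ⟨congrArg Prod.fst (hper k), congrArg Prod.snd (hper k)⟩

/-- An eventually periodic expansion has an eventually periodic sequence of offsets. -/
lemma SignedExpansion.exists_isPeriodicOffset (E : SignedExpansion X Y) {N p : ℕ} (hp : 0 < p)
    (hper : ∀ n, N ≤ n → E.r (n + p) = E.r n ∧ E.θ (n + p) = E.θ n) :
    ∃ δ, E.IsPeriodicOffset δ N p := by
  let e : ℕ → F := fun n => ∏ i ∈ Finset.range n, E.r i
  have e_succ : ∀ n, e (n + 1) = e n * E.r n := fun n => Finset.prod_range_succ _ _
  have e_ne : ∀ n, e n ≠ 0 := fun n => Finset.prod_ne_zero_iff.2 fun i _ => E.r_ne_zero i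
  have hanti : StrictAnti fun n => |X (e n)| := by
    refine strictAnti_nat_of_succ_lt fun n => ?_
    have h0 : 0 < |X (e n)| := abs_pos.2 (by simpa using e_ne n)
    rw [e_succ, map_mul, abs_mul]
    nlinarith [E.abs_X_le n]
  have hne : e N - e (N + p) ≠ 0 := fun h => by
    have := hanti (show N < N + p by omega)
    simp only [sub_eq_zero.1 h, lt_irrefl] at this
  let c : ℕ → F := fun n => ∑ i ∈ Finset.range n, E.η i * e (i + 1)
  have c_succ : ∀ n, c (n + 1) = c n + E.η n * e (n + 1) := fun n => Finset.sum_range_succ _ _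
  -- The initial offset solving the linear equation `δ (N + p) = δ N`. It is solvable because `|X (e
  -- n)|` strictly decreases, and the solution lies in `F`.
  let d : F := (e (N + p) * c N - e N * c (N + p)) / (e N - e (N + p))
  have hsucc : ∀ n, (d + c (n + 1)) / e (n + 1) = (d + c n) / e n / E.r n + E.η n := by
    intro n
    rw [c_succ, e_succ]
    have h1 := e_ne n
    have h2 := E.r_ne_zero n
    field_simp
    ring
  have hb : ∀ n, N ≤ n → E.b (n + p) = E.b n := by
    intro n hn
    have h1 := E.r_succ (n + p)
    rw [show n + p + 1 = n + 1 + p by ring, (hper n hn).1, (hper (n + 1) (by omega)).1,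
      E.r_succ n] at h1
    have h2 := congrArg X (sub_left_injective h1)
    simpa using h2.symm
  have hη : ∀ n, N ≤ n → E.η (n + p) = E.η n := by
    intro n hn
    unfold SignedExpansion.η
    rw [hb n hn, (hper n hn).2]
  refine ⟨fun n => (d + c n) / e n, hp, hsucc, fun n hn => (hper n hn).1,
    fun n hn => (hper n hn).2, fun n hn => ?_⟩
  obtain ⟨k, rfl⟩ := Nat.exists_eq_add_of_le hn
  induction k with
  | zero =>
    have h1 := e_ne N
    have h2 := e_ne (N + p)
    simp only [add_zero]
    rw [div_eq_div_iff h2 h1]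
    have h3 : d * (e N - e (N + p)) = e (N + p) * c N - e N * c (N + p) := div_mul_cancel₀ _ hne
    linear_combination h3
  | succ k ih =>
    have ih := ih (by omega)
    rw [show N + (k + 1) + p = N + k + p + 1 by omega, hsucc, ih, (hper _ (by omega)).1,
      hη _ (by omega), ← hsucc]
    rfl

/-- Let `w` be a root of a monic integral quadratic polynomial. Then there is a point whose norm
distance from the lattice `ℤ + ℤ w` is large. -/
theorem exists_forall_le_norm [CharZero F] {w : F} {B C : ℤ} (hw : w ^ 2 + B * w + C = 0)
    (h4 : 4 ≤ |X w - Y w|) :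
    ∃ z : F, ∀ s t : ℤ, 0.0326 * |X w - Y w| ≤ |X (z - (s + t * w))| * |Y (z - (s + t * w))| := by
  let k := round (X w)
  let x : F := w - k
  have hX : |X x| ≤ 1 / 2 := by simpa [x] using abs_sub_round (X w)
  have hsub : X x - Y x = X w - Y w := by simp [x]
  have hY : 3 ≤ |Y x| := by
    have := abs_sub (X x) (Y x)
    rw [hsub] at this
    linarith
  have hXw := congrArg X hw
  have hYw := congrArg Y hw
  simp only [map_add, map_mul, map_pow, map_intCast, map_zero] at hXw hYw
  have hne : X w - Y w ≠ 0 := fun h => by rw [h] at h4; norm_num at h4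
  have hD : (0 : ℤ) < B ^ 2 - 4 * C := by
    have h1 : (X w + Y w) + B = 0 := by
      refine (mul_eq_zero.1 (?_ : (X w - Y w) * (X w + Y w + B) = 0)).resolve_left hne
      linear_combination hXw - hYw
    have h2 : (X w - Y w) ^ 2 = (B ^ 2 - 4 * C : ℝ) := by
      linear_combination 4 * hXw - (3 * X w - Y w + B) * h1
    have h3 : (0 : ℝ) < B ^ 2 - 4 * C := by rw [← h2]; positivity
    exact_mod_cast h3
  have hred : IsReduced X Y (B ^ 2 - 4 * C) x := by
    refine ⟨hX, by linarith, 1, 2 * k + B, k ^ 2 + B * k + C, ?_, by ring⟩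
    simp only [x]
    push_cast
    linear_combination hw
  obtain ⟨E, N, p, hE, hp, hper⟩ := exists_signedExpansion hD hred hY
  obtain ⟨δ, P⟩ := E.exists_isPeriodicOffset hp hper
  -- Twice the difference from a lattice point has odd coordinates relative to `δ 0`; halving
  -- accounts for `0.0326 = 0.1304 / 4`.
  refine ⟨(δ 0 + 1 + x) / 2, fun s t => ?_⟩
  have hS : Odd (1 - 2 * (s + t * k)) := ⟨-(s + t * k), by ring⟩
  have hT : Odd (2 * t - 1) := ⟨t - 1, by ring⟩
  have key := P.isFar 0 hS hT
  unfold SignedExpansion.IsFar at key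
  rw [hE, hsub] at key
  have e : (δ 0 + 1 + x) / 2 - (s + t * w) =
      (δ 0 + ((1 - 2 * (s + t * k) : ℤ) : F) - ((2 * t - 1 : ℤ) : F) * x) / 2 := by
    simp only [x]
    push_cast
    ring
  rw [e, map_div₀, map_div₀, abs_div, abs_div, map_ofNat, map_ofNat, abs_two]
  linarith

end orbit

/-! ### Embeddings, an integral generator and the euclidean minimum -/

section setup

lemma sq_eq_trace_mul_sub_norm {F : Type*} [Field F] [NumberField F] {X Y : F →+* ℝ}
    (hN : ∀ z : F, ((Algebra.norm ℚ z : ℚ) : ℝ) = X z * Y z)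
    (hT : ∀ z : F, ((Algebra.trace ℚ F z : ℚ) : ℝ) = X z + Y z) (z : F) :
    z ^ 2 = (Algebra.trace ℚ F z : ℚ) * z - (Algebra.norm ℚ z : ℚ) := by
  apply X.injective
  rw [map_pow, map_sub, map_mul, map_ratCast, map_ratCast, hN, hT]
  ring

variable (F : Type u) [Field F] [NumberField F] [Algebra.IsQuadraticExtension ℚ F]

/-- The two embeddings of a real quadratic field, and the norm and trace in terms of them. -/
lemma exists_embeddings [NumberField.IsTotallyReal F] : ∃ X Y : F →+* ℝ, X ≠ Y ∧
    (∀ z : F, ((Algebra.norm ℚ z : ℚ) : ℝ) = X z * Y z) ∧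
    ∀ z : F, ((Algebra.trace ℚ F z : ℚ) : ℝ) = X z + Y z := by
  classical
  obtain ⟨v⟩ : Nonempty (NumberField.InfinitePlace F) := inferInstance
  let X := NumberField.InfinitePlace.embedding_of_isReal
    (NumberField.IsTotallyReal.isReal v)
  have hcard : (Finset.univ : Finset Gal(F/ℚ)).card = 2 := by
    rw [Finset.card_univ, ← Nat.card_eq_fintype_card, IsGalois.card_aut_eq_finrank,
      Algebra.IsQuadraticExtension.finrank_eq_two]
  obtain ⟨σ, hσ, huniv⟩ : ∃ σ : Gal(F/ℚ), 1 ≠ σ ∧ (Finset.univ : Finset Gal(F/ℚ)) = {1, σ} := by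
    obtain ⟨a, b, hab, h⟩ := Finset.card_eq_two.1 hcard
    have h1 : (1 : Gal(F/ℚ)) ∈ ({a, b} : Finset _) := h ▸ Finset.mem_univ _
    rcases Finset.mem_insert.1 h1 with rfl | h1
    · exact ⟨b, hab, h⟩
    · rw [Finset.mem_singleton] at h1
      subst h1
      exact ⟨a, hab.symm, h.trans (Finset.pair_comm _ _)⟩
  refine ⟨X, X.comp (σ : F ≃+* F).toRingHom, ?_, fun z => ?_, fun z => ?_⟩
  · intro h
    apply hσ
    ext z
    have := RingHom.congr_fun h z
    exact X.injective this
  · have h := congrArg X (Algebra.norm_eq_prod_automorphisms ℚ z)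
    rw [huniv, Finset.prod_pair hσ, map_mul, eq_ratCast, map_ratCast] at h
    exact h
  · have h := congrArg X (trace_eq_sum_automorphisms (K := ℚ) z)
    rw [huniv, Finset.sum_pair hσ, map_add, eq_ratCast, map_ratCast] at h
    exact h

variable {F}

/-- The ring of integers is `ℤ + ℤ w` for some `w`. -/
lemma exists_generator {X Y : F →+* ℝ}
    (hT : ∀ z : F, ((Algebra.trace ℚ F z : ℚ) : ℝ) = X z + Y z) :
    ∃ w : 𝓞 F, (∀ q : 𝓞 F, ∃ s t : ℤ, q = s + t * w) ∧
      (X w - Y w) ^ 2 = (NumberField.discr F : ℝ) := by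
  have hrank : Module.finrank ℤ (𝓞 F) = 2 := by
    rw [NumberField.RingOfIntegers.rank, Algebra.IsQuadraticExtension.finrank_eq_two]
  let b := Module.finBasisOfFinrankEq ℤ (𝓞 F) hrank
  have hrepr : ∀ q : 𝓞 F, ∃ s t : ℤ, q = s * b 0 + t * b 1 := fun q => by
    refine ⟨b.repr q 0, b.repr q 1, ?_⟩
    have := b.sum_repr q
    rw [Fin.sum_univ_two, zsmul_eq_mul, zsmul_eq_mul] at this
    exact this.symm
  obtain ⟨p, q, hpq⟩ := hrepr 1
  -- A common divisor `g` of `p` and `q` would divide 1 in `𝓞 F`; taking norms makes `g²` a unit of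
  -- `ℤ`. So 1 extends to an integral basis.
  have hcop : IsCoprime p q := by
    rw [Int.isCoprime_iff_gcd_eq_one]
    obtain ⟨p', hp'⟩ := Int.gcd_dvd_left p q
    obtain ⟨q', hq'⟩ := Int.gcd_dvd_right p q
    set g := Int.gcd p q
    have h1 : (algebraMap ℤ (𝓞 F) g) * (p' * b 0 + q' * b 1) = 1 := by
      have hp'' : (p : 𝓞 F) = g * p' := by exact_mod_cast congrArg (Int.cast : ℤ → 𝓞 F) hp'
      have hq'' : (q : 𝓞 F) = g * q' := by exact_mod_cast congrArg (Int.cast : ℤ → 𝓞 F) hq'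
      rw [eq_intCast, Int.cast_natCast]
      linear_combination -hpq - b 0 * hp'' - b 1 * hq''
    have h2 := congrArg (Algebra.norm ℤ) h1
    rw [map_mul, map_one (Algebra.norm ℤ), Algebra.norm_algebraMap, hrank] at h2
    have h3 : IsUnit ((g : ℤ) ^ 2) := IsUnit.of_mul_eq_one _ h2
    rw [isUnit_pow_iff two_ne_zero, Int.isUnit_iff] at h3
    omega
  obtain ⟨u, v, huv⟩ := hcop
  have huv' : (u : 𝓞 F) * p + v * q = 1 := by exact_mod_cast congrArg (Int.cast : ℤ → 𝓞 F) huv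
  refine ⟨-v * b 0 + u * b 1, fun z => ?_, ?_⟩
  · obtain ⟨s, t, rfl⟩ := hrepr z
    refine ⟨s * u + t * v, -(s * q) + t * p, ?_⟩
    push_cast
    rw [← mul_one ((s : 𝓞 F) * u + t * v), hpq]
    linear_combination (-(s * b 0) - t * b 1 : 𝓞 F) * huv'
  · have hdiscr : (NumberField.discr F : ℝ) = (X (b 0) * Y (b 1) - X (b 1) * Y (b 0)) ^ 2 := by
      have htr : ∀ z : 𝓞 F, ((Algebra.trace ℤ (𝓞 F) z : ℤ) : ℝ) = X z + Y z := fun z => by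
        rw [← hT, ← Algebra.coe_trace_int]; simp
      rw [← NumberField.discr_eq_discr F b, Algebra.discr_def, Matrix.det_fin_two]
      simp only [Algebra.traceMatrix_apply, Algebra.traceForm_apply]
      push_cast
      simp only [htr, map_mul]
      ring
    have hX : 1 = (p : ℝ) * X (b 0) + q * X (b 1) := by
      have := congrArg (fun z : 𝓞 F => X z) hpq
      simpa using this
    have hY : 1 = (p : ℝ) * Y (b 0) + q * Y (b 1) := by
      have := congrArg (fun z : 𝓞 F => Y z) hpq
      simpa using this
    have huvR : (u : ℝ) * p + v * q = 1 := by exact_mod_cast congrArg (Int.cast : ℤ → ℝ) huv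
    rw [hdiscr]
    simp only [map_add, map_mul, map_neg, map_intCast]
    set x0 := X (b 0)
    set x1 := X (b 1)
    set y0 := Y (b 0)
    set y1 := Y (b 1)
    have e : (-v * x0 + u * x1) - (-v * y0 + u * y1) = -(x0 * y1 - x1 * y0) := by
      linear_combination (-v * x0 + u * x1) * hY - (-v * y0 + u * y1) * hX -
        (x0 * y1 - x1 * y0) * huvR
    rw [e, neg_sq]

/-- Ennola's lower bound for the euclidean minimum of a real quadratic field. -/
theorem exists_forall_lt_norm [NumberField.IsTotallyReal F] {T : ℝ} (hT1 : 1 ≤ T)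
    (hd : (16 + 6 * √6) ^ 2 * T ^ 2 < (NumberField.discr F : ℝ)) :
    ∃ z : F, ∀ q : 𝓞 F, T < ((|Algebra.norm ℚ (z - q)| : ℚ) : ℝ) := by
  obtain ⟨X, Y, -, hN, hT⟩ := exists_embeddings F
  obtain ⟨w, hw, hwd⟩ := exists_generator hT
  -- This precision suffices: `0.0326 * (16 + 6 * 2.449) > 1`.
  have h6 : (2.449 : ℝ) ≤ √6 := Real.le_sqrt_of_sq_le (by norm_num)
  have hlt : (16 + 6 * √6) * T < |X w - Y w| := by
    refine lt_of_pow_lt_pow_left₀ 2 (abs_nonneg _) ?_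
    rwa [sq_abs, hwd, mul_pow]
  obtain ⟨s, t, hst⟩ := hw (w ^ 2)
  have hquad : (w : F) ^ 2 + ((-t : ℤ) : F) * w + ((-s : ℤ) : F) = 0 := by
    have := congrArg (fun z : 𝓞 F => (z : F)) hst
    simp only [map_pow, map_add, map_mul, map_intCast] at this
    push_cast
    linear_combination this
  obtain ⟨z, hz⟩ := exists_forall_le_norm (X := X) (Y := Y) hquad (by nlinarith)
  refine ⟨z, fun q => ?_⟩
  obtain ⟨s, t, rfl⟩ := hw q
  have := hz s t
  push_cast
  rw [hN, abs_mul]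
  refine lt_of_lt_of_le ?_ this
  nlinarith

end setup

/-! ### Finiteness, and division with denominators -/

/-- A property of real quadratic fields which bounds the discriminant holds for finitely many
fields only. -/
lemma finitelyManySatisfy_of_discr_le
    {P : ∀ (F : Type u) [Field F] [NumberField F], Prop} (B : ℕ)
    (h : ∀ (F : Type u) [Field F] [NumberField F] [Algebra.IsQuadraticExtension ℚ F]
      [NumberField.IsTotallyReal F], P F → |NumberField.discr F| ≤ B) :
    FinitelyManySatisfy.{u} P := by
  classical
  -- Hermite's theorem for subfields of `ℝ`; the field is realised there by one of its embeddings.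
  have hfin := (NumberField.finite_of_discr_bdd ℝ B).image Subtype.val
  refine ⟨hfin.toFinset, fun F _ _ _ _ hP => ?_⟩
  obtain ⟨X, -⟩ := exists_embeddings F
  let φ : F →ₐ[ℚ] ℝ := X.toRatAlgHom
  let e : F ≃ₐ[ℚ] φ.fieldRange := AlgEquiv.ofInjectiveField φ
  have hfd : FiniteDimensional ℚ φ.fieldRange := Module.Finite.equiv e.toLinearEquiv
  have : NumberField φ.fieldRange := @NumberField.mk _ _ inferInstance hfd
  refine ⟨φ.fieldRange, ?_, ⟨e.toRingEquiv⟩⟩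
  rw [Set.Finite.mem_toFinset]
  refine ⟨⟨φ.fieldRange, hfd⟩, ?_, rfl⟩
  have hd := NumberField.discr_eq_discr_of_ringEquiv F e.toRingEquiv
  have := h F hP
  rw [hd] at this
  exact this

variable {F : Type u} [Field F] [NumberField F]

lemma norm_div (x : F) {y : F} (hy : y ≠ 0) :
    Algebra.norm ℚ (x / y) = Algebra.norm ℚ x / Algebra.norm ℚ y := by
  rw [eq_div_iff (Algebra.norm_ne_zero_iff.2 hy), ← map_mul, div_mul_cancel₀ _ hy]

lemma mem_fracIntegers_add {n : ℕ} {x y : F} (hx : x ∈ fracIntegers F n)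
    (hy : y ∈ fracIntegers F n) : x + y ∈ fracIntegers F n := by
  obtain ⟨a, rfl⟩ := hx
  obtain ⟨b, rfl⟩ := hy
  exact ⟨a + b, by push_cast; ring⟩

lemma mul_mem_fracIntegers {n : ℕ} {x : F} (hx : x ∈ fracIntegers F n) (a : 𝓞 F) :
    x * a ∈ fracIntegers F n := by
  obtain ⟨b, rfl⟩ := hx
  exact ⟨b * a, by push_cast; ring⟩

lemma coe_mem_fracIntegers {n : ℕ} (hn : 0 < n) (a : 𝓞 F) : (a : F) ∈ fracIntegers F n := by
  refine ⟨n * a, ?_⟩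
  have : (n : F) ≠ 0 := by exact_mod_cast hn.ne'
  push_cast
  field_simp

lemma lcm_Icc_pos (n : ℕ) : 0 < (Finset.Icc 1 n).lcm id := by
  refine Nat.pos_of_ne_zero fun h => ?_
  rw [Finset.lcm_eq_zero_iff] at h
  simp at h

variable [Algebra.IsQuadraticExtension ℚ F]

lemma norm_div_natCast (z : F) {n : ℕ} (hn : 0 < n) :
    Algebra.norm ℚ (z / n) = Algebra.norm ℚ z / (n : ℚ) ^ 2 := by
  have : Algebra.norm ℚ (n : F) = (n : ℚ) ^ 2 := by
    have := Algebra.norm_algebraMap (R := ℚ) (S := F) (n : ℚ)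
    rwa [map_natCast, Algebra.IsQuadraticExtension.finrank_eq_two] at this
  rw [norm_div _ (by exact_mod_cast hn.ne'), this]

/-- Every element of `F` can be moved into the fundamental parallelogram by an integer. -/
lemma exists_sub_mem_fundDomain {ω : F} (hω : IsStandardGenerator ω) (z : F) :
    ∃ q : 𝓞 F, toPlane (z - q) ∈ fundDomain ω := by
  obtain ⟨m, s, hm1, hm, hs, hω⟩ := hω
  have hs' : ∀ q : ℚ, s ≠ q := by
    rintro q rfl
    have h1 : q ^ 2 = (m : ℚ) := by exact_mod_cast hs
    have h2 : IsSquare m := by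
      rw [← Rat.isSquare_natCast_iff]
      exact ⟨q, by rw [← h1, sq]⟩
    obtain ⟨k, rfl⟩ := h2
    have := hm k dvd_rfl
    rw [Nat.isUnit_iff] at this
    subst this
    omega
  -- Only integrality and irrationality of `ω` are used, not that `1, ω` generate `𝓞 F`.
  obtain ⟨hint, hrat⟩ : IsIntegral ℤ ω ∧ ∀ q : ℚ, ω ≠ q := by
    split_ifs at hω with h4
    · constructor
      · obtain ⟨k, hk⟩ : ∃ k : ℕ, m = 4 * k + 1 := ⟨m / 4, by omega⟩
        refine ⟨Polynomial.X ^ 2 - Polynomial.X - Polynomial.C (k : ℤ), ?_, ?_⟩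
        · monicity!
        · have hk' : (m : F) = 4 * k + 1 := by exact_mod_cast congrArg (Nat.cast : ℕ → F) hk
          rw [hk'] at hs
          simp [hω]
          linear_combination hs / 4
      · rintro q rfl
        apply hs' (2 * q - 1)
        push_cast
        rw [hω]
        ring
    · subst hω
      refine ⟨⟨Polynomial.X ^ 2 - Polynomial.C (m : ℤ), ?_, ?_⟩, hs'⟩
      · monicity!
      · simp [hs]
  obtain ⟨a, b, hab⟩ : ∃ a b : ℚ, z = a + b * ω := by
    have hli : LinearIndependent ℚ ![(1 : F), ω] := by
      rw [LinearIndependent.pair_iff]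
      intro c d hcd
      rw [Rat.smul_def, Rat.smul_def, mul_one] at hcd
      have hd : d = 0 := by
        by_contra hd
        apply hrat (-c / d)
        have : (d : F) ≠ 0 := by exact_mod_cast hd
        push_cast
        field_simp
        linear_combination hcd
      subst hd
      simpa using hcd
    have hspan := hli.span_eq_top_of_card_eq_finrank'
      (by rw [Algebra.IsQuadraticExtension.finrank_eq_two]; rfl)
    have hz : z ∈ Submodule.span ℚ (Set.range ![(1 : F), ω]) := hspan ▸ Submodule.mem_top
    rw [Matrix.range_cons, Matrix.range_cons, Matrix.range_empty, Set.union_empty,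
      Set.singleton_union, Submodule.mem_span_pair] at hz
    obtain ⟨a, b, hab⟩ := hz
    refine ⟨a, b, ?_⟩
    rw [← hab, Rat.smul_def, Rat.smul_def, mul_one]
  obtain ⟨w, hw⟩ : ∃ w : 𝓞 F, (w : F) = ω := ⟨⟨ω, hint⟩, rfl⟩
  refine ⟨(⌊a⌋ : 𝓞 F) + ⌊b⌋ * w, (Int.fract a : ℚ), ⟨?_, ?_⟩, (Int.fract b : ℚ), ⟨?_, ?_⟩, ?_⟩
  · exact_mod_cast Int.fract_nonneg a
  · exact_mod_cast Int.fract_lt_one a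
  · exact_mod_cast Int.fract_nonneg b
  · exact_mod_cast Int.fract_lt_one b
  · have hz : z - ((⌊a⌋ : 𝓞 F) + ⌊b⌋ * w : 𝓞 F) = (Int.fract a : ℚ) + (Int.fract b : ℚ) * ω := by
      rw [← Int.self_sub_floor, ← Int.self_sub_floor, hab]
      push_cast
      have hw' : algebraMap (𝓞 F) F w = ω := hw
      simp only [map_intCast, hw']
      ring
    rw [hz]
    funext σ
    simp [toPlane]

variable [NumberField.IsTotallyReal F]

/-- The continued fractions `[q₁, q₂]` with `|Nm q₂| ≤ n` have denominator `lcm (1, …, n)`. -/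
lemma contFrac_mem_fracIntegers {n : ℕ} {p : 𝓞 F × 𝓞 F} (hp : p ∈ denomLE F n) :
    contFrac p.1 p.2 ∈ fracIntegers F ((Finset.Icc 1 n).lcm id) := by
  obtain ⟨X, Y, -, hN, hT⟩ := exists_embeddings F
  obtain ⟨q₁, q₂⟩ := p
  obtain ⟨h0, hle⟩ := hp
  simp only at h0 hle ⊢
  refine mem_fracIntegers_add (coe_mem_fracIntegers (lcm_Icc_pos n) q₁) ?_
  have hq := sq_eq_trace_mul_sub_norm hN hT (q₂ : F)
  rw [← Algebra.coe_norm_int, ← Algebra.coe_trace_int] at hq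
  rw [← Algebra.coe_norm_int] at hle
  set N := Algebra.norm ℤ q₂
  have hN0 : N ≠ 0 := Algebra.norm_ne_zero_iff.2 h0
  have hle' : |N| ≤ n := by exact_mod_cast hle
  have hdvd : N.natAbs ∣ (Finset.Icc 1 n).lcm id := by
    refine Finset.dvd_lcm (f := id) (Finset.mem_Icc.2 ⟨?_, ?_⟩)
    · exact Nat.one_le_iff_ne_zero.2 (Int.natAbs_ne_zero.2 hN0)
    · rw [Int.abs_eq_natAbs] at hle'
      exact_mod_cast hle'
  obtain ⟨k, hk⟩ := Int.natAbs_dvd.1 (Int.natCast_dvd_natCast.2 hdvd)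
  have ht := lcm_Icc_pos n
  set t := (Finset.Icc 1 n).lcm id
  -- From `q₂ (Tr q₂ - q₂) = Nm q₂` and `t = k Nm q₂`, the fraction `1 / q₂` is `k (Tr q₂ - q₂) /
  -- t`.
  refine ⟨k * (Algebra.trace ℤ (𝓞 F) q₂ - q₂), ?_⟩
  have hk' : (t : F) = N * k := by exact_mod_cast congrArg (Int.cast : ℤ → F) hk
  have ht0 : (t : F) ≠ 0 := by exact_mod_cast ht.ne'
  have hq0 : (q₂ : F) ≠ 0 := by simpa using h0
  rw [div_eq_div_iff hq0 ht0, hk']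
  push_cast at hq ⊢
  simp only [map_intCast]
  linear_combination (k : F) * hq

lemma planeNorm_toPlane (x : F) : planeNorm (toPlane x) = ((Algebra.norm ℚ x : ℚ) : ℝ) := by
  classical
  obtain ⟨X, Y, hXY, hN, hT⟩ := exists_embeddings F
  have huniv : (Finset.univ : Finset (F →+* ℝ)) = {X, Y} := by
    have hcard : Fintype.card (F →+* ℝ) ≤ 2 := by
      have h1 := NumberField.Embeddings.card F ℂ
      rw [Algebra.IsQuadraticExtension.finrank_eq_two] at h1
      rw [← h1]
      refine Fintype.card_le_of_injective (fun f => Complex.ofRealHom.comp f) fun f g h => ?_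
      ext z
      exact Complex.ofReal_injective (RingHom.congr_fun h z)
    refine (Finset.eq_of_subset_of_card_le (Finset.subset_univ _) ?_).symm
    rw [Finset.card_univ, Finset.card_pair hXY]
    exact hcard
  rw [hN, planeNorm, huniv, Finset.prod_pair hXY]
  rfl

/-- Translate `α / β` into the parallelogram; a covering region has radius `1 / |Nm q₂| ≤ 1`, so its
centre, translated back, serves as the quotient. -/
lemma IsSmoothEuclidean.hasFracDivision {n : ℕ} (h : IsSmoothEuclidean F n) :
    HasFracDivision F ((Finset.Icc 1 n).lcm id) := by
  obtain ⟨ω, hω, hcover⟩ := h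
  intro α β hβ
  have hβ' : (β : F) ≠ 0 := by simpa using hβ
  obtain ⟨γ, hγ⟩ := exists_sub_mem_fundDomain hω ((α : F) / β)
  obtain ⟨p, hp, hV⟩ := Set.mem_iUnion₂.1 (hcover hγ)
  have ht := lcm_Icc_pos n
  have hq := mem_fracIntegers_add (contFrac_mem_fracIntegers hp) (coe_mem_fracIntegers ht γ)
  set q := contFrac p.1 p.2 + γ with hqdef
  refine ⟨q, hq, α - q * β, ?_, by ring, ?_⟩
  · have h1 := mul_mem_fracIntegers hq (-β)
    have h2 := mem_fracIntegers_add (coe_mem_fracIntegers ht α) h1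
    convert h2 using 1
    push_cast
    ring
  · have e1 : toPlane ((α : F) / β - γ) - toPlane (contFrac p.1 p.2) =
        toPlane ((α : F) / β - q) := by
      funext σ
      simp [toPlane, hqdef]
      ring
    have e2 : |Algebra.norm ℚ ((α : F) / β - q)| < 1 := by
      have h1 : |planeNorm (toPlane ((α : F) / β - γ) - toPlane (contFrac p.1 p.2))| <
        1 / |((Algebra.norm ℚ (p.2 : F) : ℚ) : ℝ)| := hV
      rw [e1, planeNorm_toPlane] at h1
      have h2 : 1 ≤ |Algebra.norm ℚ (p.2 : F)| := by
        rw [← Algebra.coe_norm_int]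
        have : 0 < |Algebra.norm ℤ p.2| := abs_pos.2 (Algebra.norm_ne_zero_iff.2 hp.1)
        exact_mod_cast this
      have h3 : (1 : ℝ) ≤ |((Algebra.norm ℚ (p.2 : F) : ℚ) : ℝ)| := by exact_mod_cast h2
      have h4 := h1.trans_le (div_le_one_of_le₀ h3 (by positivity))
      exact_mod_cast h4
    have e3 : (α : F) - q * β = ((α : F) / β - q) * β := by field_simp
    rw [e3, map_mul, abs_mul]
    exact mul_lt_of_lt_one_left (abs_pos.2 (Algebra.norm_ne_zero_iff.2 hβ')) e2

/-- A point of `F` which is far from `(1 / n) 𝓞 F`. -/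
lemma exists_forall_one_lt_norm {n : ℕ} (hn : 0 < n)
    (hd : (16 + 6 * √6) ^ 2 * (n : ℝ) ^ 4 < (NumberField.discr F : ℝ)) :
    ∃ z : F, ∀ q ∈ fracIntegers F n, 1 < |Algebra.norm ℚ (z - q)| := by
  have hn1 : (1 : ℝ) ≤ n := by exact_mod_cast hn
  obtain ⟨z, hz⟩ := exists_forall_lt_norm (F := F) (T := (n : ℝ) ^ 2) (one_le_pow₀ hn1)
    (by rwa [← pow_mul])
  refine ⟨z / n, ?_⟩
  rintro _ ⟨γ, rfl⟩
  rw [← sub_div, norm_div_natCast _ hn, abs_div, abs_of_nonneg (sq_nonneg (n : ℚ)),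
    one_lt_div (by positivity)]
  exact_mod_cast hz γ

/-- Division of `α` by `β` yields a quotient within norm distance less than 1 of `α / β`,
contradicting a point far from `(1/n)𝓞 F`. -/
lemma HasFracDivision.discr_le {n : ℕ} (hn : 0 < n) (h : HasFracDivision F n) :
    (NumberField.discr F : ℝ) ≤ (16 + 6 * √6) ^ 2 * (n : ℝ) ^ 4 := by
  by_contra! hd
  obtain ⟨z, hz⟩ := exists_forall_one_lt_norm hn hd
  obtain ⟨α, β, hβ, rfl⟩ := IsFractionRing.div_surjective (A := 𝓞 F) z
  have hβ0 : β ≠ 0 := nonZeroDivisors.ne_zero hβ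
  have hβ' : (β : F) ≠ 0 := by simpa using hβ0
  obtain ⟨q, hq, r, -, hαβ, hr⟩ := h α β hβ0
  have e : (α : F) / β - q = r / β := by
    rw [hαβ]; field_simp; ring
  have h1 := hz q hq
  rw [show algebraMap (𝓞 F) F α / algebraMap (𝓞 F) F β - q = r / β from e, norm_div _ hβ', abs_div,
    one_lt_div (abs_pos.2 (Algebra.norm_ne_zero_iff.2 hβ'))] at h1
  exact lt_asymm h1 hr

lemma discr_nonneg : 0 ≤ NumberField.discr F := by
  obtain ⟨X, Y, -, hN, hT⟩ := exists_embeddings F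
  obtain ⟨w, -, hw⟩ := exists_generator hT
  have : (0 : ℝ) ≤ NumberField.discr F := by rw [← hw]; positivity
  exact_mod_cast this

lemma finitelyManySatisfy_hasFracDivision {n : ℕ} (hn : 0 < n) :
    FinitelyManySatisfy.{u} (fun F _ _ => HasFracDivision F n) := by
  refine finitelyManySatisfy_of_discr_le ⌈(16 + 6 * √6) ^ 2 * (n : ℝ) ^ 4⌉₊ fun F _ _ _ _ h => ?_
  rw [abs_of_nonneg discr_nonneg]
  have := (h.discr_le hn).trans (Nat.le_ceil _)
  exact_mod_cast this

end RealQuadratic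

theorem mainTheorem3 (n : ℕ) (hn : 0 < n) :
    RealQuadratic.FinitelyManySatisfy.{u}
        (fun F _ _ => RealQuadratic.IsSmoothEuclidean F n) ∧
    RealQuadratic.FinitelyManySatisfy.{u}
        (fun F _ _ => RealQuadratic.HasFracDivision F n) ∧
    ∀ (F : Type u) [Field F] [NumberField F] [Algebra.IsQuadraticExtension ℚ F]
      [NumberField.IsTotallyReal F],
      (RealQuadratic.IsSmoothEuclidean F n →
        RealQuadratic.HasFracDivision F ((Finset.Icc 1 n).lcm id)) ∧
      ((16 + 6 * Real.sqrt 6) ^ 2 * (((Finset.Icc 1 n).lcm id : ℕ) : ℝ) ^ 4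
          < (NumberField.discr F : ℝ) →
        ∃ z : F, ∀ q ∈ RealQuadratic.CF₂ F n, 1 < |Algebra.norm ℚ (z - q)|) := by
  have ht := RealQuadratic.lcm_Icc_pos n
  refine ⟨?_, RealQuadratic.finitelyManySatisfy_hasFracDivision hn, fun F _ _ _ _ =>
    ⟨fun h => h.hasFracDivision, fun hd => ?_⟩⟩
  · obtain ⟨S, hS⟩ := RealQuadratic.finitelyManySatisfy_hasFracDivision.{u} ht
    exact ⟨S, fun F _ _ _ _ h => hS F h.hasFracDivision⟩
  · obtain ⟨z, hz⟩ := RealQuadratic.exists_forall_one_lt_norm ht hd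
    refine ⟨z, ?_⟩
    rintro _ ⟨p, hp, rfl⟩
    exact hz _ (RealQuadratic.contFrac_mem_fracIntegers hp)
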